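/- Let $\mathbb K$ be a field of characteristic $0$ and let $\chi\colon L\to M$ be a morphism of differential ($\mathbb Z$-)graded Lie algebras over $\mathbb K$. Let $C_\chi$ be the suspended mapping cone, $C_\chi^i=L^i\oplus M^{i-1}$, with differential $\delta(l,m)=(dl,\chi(l)-dm)$, and let $C_\chi[1]$ be its shift, $C_\chi[1]^i=C_\chi^{i+1}=L^{i+1}\oplus M^i$. Let $H_\chi=\{(l,\omega)\in L\times M[t,dt]\mid \omega|_{t=0}=0,\ \omega|_{t=1}=\chi(l)\}$, a differential graded Lie algebra, with $q_1(x)=-dx$ and $q_2(x\odot y)=(-1)^{\deg x}[x,y]$ on $H_\chi[1]$, and define $$\imath(l,m)=(l,\,t\chi(l)+dt\cdot m),\qquad \pi(l,\omega)=\Bigl(l,\int_0^1\omega\Bigr),\qquad \mathcal K(l,\omega)=\Bigl(0,\ \int_0^t\omega-t\int_0^1\omega\Bigr).$$ Let $\widetilde C(\chi)$ be $C_\chi$ with the brackets $\langle\,\rangle_n\colon\bigodot^n C_\chi[1]\to C_\chi[1]$, $n\ge1$, obtained by homotopy transfer along these maps: let $\imath_\infty\colon\bigoplus_{n\ge1}\bigodot^n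 C_\chi[1]\to\bigoplus_{n\ge1}\bigodot^n H_\chi[1]$ be the morphism of symmetric coalgebras whose corestriction $\imath^1_\infty$ to $H_\chi[1]$ satisfies the recursion $\imath^1_\infty=\imath+\mathcal K q_2\imath_\infty$; then $\langle\,\rangle_1=-\delta$, and for $n\ge2$ the bracket $\langle\,\rangle_n$ is the restriction of $\pi q_2\imath_\infty$ to $\bigodot^n C_\chi[1]$. Then $\widetilde C(\chi)$ is an $L_\infty$-algebra: the maps $\langle\,\rangle_n$ have degree $1$, are graded symmetric, and induce a coderivation of square zero on the reduced symmetric coalgebra of $C_\chi[1]$. Its brackets are given by the following formulas, for $l,l_j\in L$ and $m,m_i\in M$, homogeneous wherever a degree occurs: $$\langle(l,m)\rangle_1=(-dl,\,-\chi(l)+dm),$$ $$\langle l_1\odot l_2\rangle_2=(-1)^{\deg_L(l_1)}[l_1,l_2]\in L,\qquad \langle m\otimes l\rangle_2=\frac{(-1)^{\deg_M(m)+1}}{2}[m,\chi(l)]\in M,\qquad \langle m_1\odot m_2\rangle_2=0,$$ $$\langle m_1\odot\cdots\odot m_n\otimes l_1\odot\cdots\odot l_k\rangle_{n+k}=0\qquad\text{if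 } n+k\ge3 \text{ and } k\ne1,$$ and, for $n\ge2$, $$\langle m_1\odot\cdots\odot m_n\otimes l\rangle_{n+1}=-(-1)^{\sum_{i=1}^n\deg_M(m_i)}\,\frac{B_n}{n!}\sum_{\sigma\in S_n}\varepsilon(\sigma)\,[m_{\sigma(1)},[m_{\sigma(2)},\cdots,[m_{\sigma(n)},\chi(l)]\cdots]]\in M.$$ Here $\varepsilon(\sigma)$ is the Koszul sign, determined by $m_{\sigma(1)}\odot\cdots\odot m_{\sigma(n)}=\varepsilon(\sigma)\,m_1\odot\cdots\odot m_n$, and the $B_n$ are the Bernoulli numbers, $\sum_{n\ge0}B_n x^n/n!=x/(e^x-1)$. -/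

import Mathlib

open scoped TensorProduct Polynomial

noncomputable section

namespace ConeLInfinity

/-! ### Graded vector spaces: parity projections and Koszul signs -/

section Graded

variable {K V : Type*} [Field K] [AddCommGroup V] [Module K V]

/-- The projection of `V = ⨁ Vⁱ` onto the sum of the `Vⁱ` with `i ≡ b` modulo `2`. -/
def parityProj (𝓥 : ℤ → Submodule K V) [DirectSum.Decomposition 𝓥] (b : ZMod 2) : V →ₗ[K] V :=
  DirectSum.toModule K ℤ V (fun i => if (i : ZMod 2) = b then (𝓥 i).subtype else 0) ∘ₗ
    (DirectSum.decomposeLinearEquiv 𝓥).toLinearMap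

/-- The sign operator `v ↦ (-1)^{deg v} v`. -/
def gradeSign (𝓥 : ℤ → Submodule K V) [DirectSum.Decomposition 𝓥] : V →ₗ[K] V :=
  parityProj 𝓥 0 - parityProj 𝓥 1

theorem parityProj_of_mem (𝓥 : ℤ → Submodule K V) [DirectSum.Decomposition 𝓥] (b : ZMod 2)
    {i : ℤ} {v : V} (hv : v ∈ 𝓥 i) :
    parityProj 𝓥 b v = if (i : ZMod 2) = b then v else 0 := by
  have h := DirectSum.decomposeLinearEquiv_apply_coe 𝓥 i ⟨v, hv⟩
  simp only at h
  simp only [parityProj, LinearMap.comp_apply, LinearEquiv.coe_coe, h, DirectSum.toModule_lof]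
  split_ifs <;> simp

theorem gradeSign_of_mem (𝓥 : ℤ → Submodule K V) [DirectSum.Decomposition 𝓥]
    {i : ℤ} {v : V} (hv : v ∈ 𝓥 i) :
    gradeSign 𝓥 v = i.negOnePow • v := by
  rcases Int.even_or_odd i with h | h
  · have h0 : (i : ZMod 2) = 0 := (ZMod.intCast_zmod_eq_zero_iff_dvd i 2).2 h.two_dvd
    simp [gradeSign, parityProj_of_mem 𝓥 _ hv, h0, Int.negOnePow_even i h]
  · have h1 : (i : ZMod 2) = 1 := by
      obtain ⟨k, rfl⟩ := h
      have : (2 : ZMod 2) = 0 := by decide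
      push_cast
      simp [this]
    simp [gradeSign, parityProj_of_mem 𝓥 _ hv, h1, Int.negOnePow_odd i h]

/-- The Koszul sign `ε(σ)` for elements of degrees `d 0, …, d (n-1)`, determined by
`v_{σ(1)} ⊙ ⋯ ⊙ v_{σ(n)} = ε(σ) v_1 ⊙ ⋯ ⊙ v_n`: every inversion of `σ` contributes
`(-1)` to the product of the two degrees. -/
def koszulSign {n : ℕ} (σ : Equiv.Perm (Fin n)) (d : Fin n → ℤ) : ℤˣ :=
  ∏ i, ∏ j, if i < j ∧ σ j < σ i then (d (σ i) * d (σ j)).negOnePow else 1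

/-- The unshuffles `S(p, n - p)`: permutations increasing on the first `p` and on the last
`n - p` places. -/
def unshuffles (p n : ℕ) : Finset (Equiv.Perm (Fin n)) :=
  {σ | ∀ i j : Fin n, i < j → ((j : ℕ) < p ∨ p ≤ (i : ℕ)) → σ i < σ j}

/-- The multilinear map which on homogeneous elements of `V` is
`(v_1, …, v_n) ↦ ε(σ) f (v_{σ(1)}, …, v_{σ(n)})`. As the Koszul sign depends only on the parities
of the degrees, it is the sum over all `e : Fin n → ZMod 2` of these expressions for the components
of the `v_i` of parity `e i`. -/
def koszulAct {W : Type*} [AddCommGroup W] [Module K W]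
    (𝓥 : ℤ → Submodule K V) [DirectSum.Decomposition 𝓥] {n : ℕ} (σ : Equiv.Perm (Fin n))
    (f : MultilinearMap K (fun _ : Fin n => V) W) : MultilinearMap K (fun _ : Fin n => V) W :=
  ∑ e : Fin n → ZMod 2, ((koszulSign σ (fun i => ((e i).val : ℤ)) : ℤ) : K) •
    (f.domDomCongr σ).compLinearMap (fun i => parityProj 𝓥 (e i))

/-- `(v_1, …, v_n) ↦ q (f (v_1, …, v_a), g (v_{a+1}, …, v_n))`, where `n = a + b`. -/
def pairing {W : Type*} [AddCommGroup W] [Module K W] (q : W →ₗ[K] W →ₗ[K] W) {a b n : ℕ}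
    (h : a + b = n) (f : MultilinearMap K (fun _ : Fin a => V) W)
    (g : MultilinearMap K (fun _ : Fin b => V) W) : MultilinearMap K (fun _ : Fin n => V) W :=
  ((TensorProduct.lift q).compMultilinearMap (f.domCoprod g)).domDomCongr
    (finSumFinEquiv.trans (finCongr h))

end Graded

/-! ### `L_∞` structures -/

/-- An `L_∞` structure, given by the suspended graded space `V[1]`, whose component of degree `i`
is `𝓥 i`, and by the maps `q_n : ⨀ⁿ V[1] → V[1]`, `n ≥ 1` (`q 0` plays no role). Linear maps
on `⨀ⁿ V[1]` are multilinear maps which are symmetric in the graded sense. The last field is the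
vanishing of the component `⨀ⁿ V[1] → V[1]` of the square of the coderivation of the reduced
symmetric coalgebra induced by the `q_n`. -/
structure IsLInfinity {K V : Type*} [Field K] [AddCommGroup V] [Module K V]
    (𝓥 : ℤ → Submodule K V) (q : ∀ n : ℕ, MultilinearMap K (fun _ : Fin n => V) V) : Prop where
  degree_one : ∀ n : ℕ, 1 ≤ n → ∀ (d : Fin n → ℤ) (v : Fin n → V), (∀ i, v i ∈ 𝓥 (d i)) →
    q n v ∈ 𝓥 (∑ i, d i + 1)
  symmetric : ∀ n : ℕ, 1 ≤ n → ∀ (d : Fin n → ℤ) (v : Fin n → V), (∀ i, v i ∈ 𝓥 (d i)) →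
    ∀ σ : Equiv.Perm (Fin n), q n (fun i => v (σ i)) = koszulSign σ d • q n v
  sq_zero : ∀ n : ℕ, 1 ≤ n → ∀ (d : Fin n → ℤ) (v : Fin n → V), (∀ i, v i ∈ 𝓥 (d i)) →
    ∑ k : Fin n, ∑ σ ∈ unshuffles (k + 1) n, koszulSign σ d •
      q (n - (k + 1) + 1) (Fin.cons
        (q (k + 1) (fun i => v (σ ⟨i, by omega⟩)))
        (fun j : Fin (n - (k + 1)) => v (σ ⟨k + 1 + j, by omega⟩))) = 0

/-! ### Homotopy transfer from a differential graded Lie algebra -/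

section Transfer

variable {K C W : Type*} [Field K] [AddCommGroup C] [Module K C] [AddCommGroup W] [Module K W]

/-- For a morphism of symmetric coalgebras `F : ⨁ ⨀ⁿ C[1] → ⨁ ⨀ⁿ W[1]` with components
`f_k : ⨀ᵏ C[1] → W[1]`, the restriction of `q₂ ∘ F` to `⨀ⁿ C[1]`, that is
`v_1 ⊙ ⋯ ⊙ v_n ↦
  ½ ∑_{0 < p < n} ∑_{σ ∈ S(p, n-p)} ε(σ) q₂ (f_p (v_{σ(1)}, …, v_{σ(p)}) ⊙ f_{n-p} (…, v_{σ(n)}))`.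
The summation index below is `p - 1`. -/
def quadraticPart (𝓒 : ℤ → Submodule K C) [DirectSum.Decomposition 𝓒]
    (q₂ : W →ₗ[K] W →ₗ[K] W) (n : ℕ)
    (f : ∀ k, k < n → MultilinearMap K (fun _ : Fin k => C) W) :
    MultilinearMap K (fun _ : Fin n => C) W :=
  (2⁻¹ : K) • ∑ p : Fin (n - 1), ∑ σ ∈ unshuffles (p + 1) n,
    koszulAct 𝓒 σ (pairing q₂ (show (p + 1 : ℕ) + (n - (p + 1)) = n by omega)
      (f (p + 1) (by omega)) (f (n - (p + 1)) (by omega)))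

/-- The components of the morphism of coalgebras `ι_∞` given by the recursion
`ι_∞¹ = ι + H q₊ ι_∞`, where the target has vanishing `q_k` for `k ≥ 3`, so that `q₊ = q₂`. -/
def transferMap (𝓒 : ℤ → Submodule K C) [DirectSum.Decomposition 𝓒]
    (q₂ : W →ₗ[K] W →ₗ[K] W) (ι : C →ₗ[K] W) (H : W →ₗ[K] W) :
    ∀ n : ℕ, MultilinearMap K (fun _ : Fin n => C) W
  | 0 => 0
  | 1 => MultilinearMap.ofSubsingleton K C W 0 ι
  | n + 2 => H.compMultilinearMap
      (quadraticPart 𝓒 q₂ (n + 2) (fun k _ => transferMap 𝓒 q₂ ι H k))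

/-- The transferred brackets, the components of `Q̂¹ = δ_{[1]} + π q₊ ι_∞`. -/
def transferBracket (𝓒 : ℤ → Submodule K C) [DirectSum.Decomposition 𝓒]
    (q₂ : W →ₗ[K] W →ₗ[K] W) (ι : C →ₗ[K] W) (H : W →ₗ[K] W) (π : W →ₗ[K] C)
    (δ₁ : C →ₗ[K] C) : ∀ n : ℕ, MultilinearMap K (fun _ : Fin n => C) C
  | 0 => 0
  | 1 => MultilinearMap.ofSubsingleton K C C 0 δ₁
  | n + 2 => π.compMultilinearMap
      (quadraticPart 𝓒 q₂ (n + 2) (fun k _ => transferMap 𝓒 q₂ ι H k))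

end Transfer

/-! ### Differential graded Lie algebras -/

/-- A differential graded Lie algebra structure on the graded vector space `L = ⨁ Lⁱ`. -/
structure DGLA {K L : Type*} [Field K] [AddCommGroup L] [Module K L]
    (𝓛 : ℤ → Submodule K L) where
  d : L →ₗ[K] L
  bracket : L →ₗ[K] L →ₗ[K] L
  d_mem : ∀ {i : ℤ} {x : L}, x ∈ 𝓛 i → d x ∈ 𝓛 (i + 1)
  d_d : ∀ x : L, d (d x) = 0
  bracket_mem : ∀ {i j : ℤ} {x y : L}, x ∈ 𝓛 i → y ∈ 𝓛 j → bracket x y ∈ 𝓛 (i + j)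
  skew : ∀ {i j : ℤ} {x y : L}, x ∈ 𝓛 i → y ∈ 𝓛 j →
    bracket x y = -((i * j).negOnePow • bracket y x)
  jacobi : ∀ {i j : ℤ} {x y : L} (z : L), x ∈ 𝓛 i → y ∈ 𝓛 j →
    bracket x (bracket y z) =
      bracket (bracket x y) z + (i * j).negOnePow • bracket y (bracket x z)
  leibniz : ∀ {i : ℤ} {x : L} (y : L), x ∈ 𝓛 i →
    d (bracket x y) = bracket (d x) y + i.negOnePow • bracket x (d y)

/-- Morphisms of differential graded Lie algebras. -/
structure DGLA.Hom {K L M : Type*} [Field K] [AddCommGroup L] [Module K L] [AddCommGroup M]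
    [Module K M] {𝓛 : ℤ → Submodule K L} {𝓜 : ℤ → Submodule K M} (A : DGLA 𝓛) (B : DGLA 𝓜) where
  toLinearMap : L →ₗ[K] M
  map_mem : ∀ {i : ℤ} {x : L}, x ∈ 𝓛 i → toLinearMap x ∈ 𝓜 i
  map_d : ∀ x : L, toLinearMap (A.d x) = B.d (toLinearMap x)
  map_bracket : ∀ x y : L,
    toLinearMap (A.bracket x y) = B.bracket (toLinearMap x) (toLinearMap y)

/-! ### The differential graded Lie algebra `M[t, dt]`

`M[t]` is `K[X] ⊗ M`, and the pair `(a, b)` of elements of `M[t]` stands for the element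
`a + dt · b` of `M[t, dt]`. -/

section Forms

variable {K M : Type*} [Field K] [AddCommGroup M] [Module K M]

variable (K) in
/-- `p ↦ ∫₀ᵗ p(s) ds` on polynomials. -/
def polyIntegral : K[X] →ₗ[K] K[X] :=
  Polynomial.lsum (fun n => ((n + 1 : K)⁻¹) • Polynomial.monomial (n + 1))

variable (M) in
/-- Evaluation `M[t] → M` at `t = c`. -/
def evalAt (c : K) : K[X] ⊗[K] M →ₗ[K] M :=
  (TensorProduct.lid K M).toLinearMap ∘ₗ LinearMap.rTensor M (Polynomial.leval c)

variable (K M) in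
/-- `b ↦ ∫₀ᵗ dt · b`. -/
def integral : K[X] ⊗[K] M →ₗ[K] K[X] ⊗[K] M := LinearMap.rTensor M (polyIntegral K)

variable (K M) in
/-- `b ↦ ∫₀¹ dt · b`. -/
def integral01 : K[X] ⊗[K] M →ₗ[K] M := evalAt M 1 ∘ₗ integral K M

variable (K M) in
/-- `x ↦ t x` as a map `M → M[t]`. -/
def tMul : M →ₗ[K] K[X] ⊗[K] M := TensorProduct.mk K K[X] M Polynomial.X

variable (K M) in
/-- `x ↦ x` (constant polynomials) as a map `M → M[t]`. -/
def const : M →ₗ[K] K[X] ⊗[K] M := TensorProduct.mk K K[X] M 1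

variable {𝓜 : ℤ → Submodule K M}

/-- The bracket of `M[t]`: `[p x, q y] = p q [x, y]`. -/
def polyBracket (B : DGLA 𝓜) : K[X] ⊗[K] M →ₗ[K] K[X] ⊗[K] M →ₗ[K] K[X] ⊗[K] M :=
  TensorProduct.map₂ (LinearMap.mul K K[X]) B.bracket

variable (𝓜) in
/-- The operator `a ↦ (-1)^{deg a} a` on `M[t]`. -/
def polySign [DirectSum.Decomposition 𝓜] : K[X] ⊗[K] M →ₗ[K] K[X] ⊗[K] M :=
  LinearMap.lTensor K[X] (gradeSign 𝓜)

variable (𝓜) in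
/-- The operator `ω ↦ (-1)^{deg ω} ω` on `M[t, dt]`. -/
def formSign [DirectSum.Decomposition 𝓜] :
    (K[X] ⊗[K] M) × (K[X] ⊗[K] M) →ₗ[K] (K[X] ⊗[K] M) × (K[X] ⊗[K] M) :=
  LinearMap.prodMap (polySign 𝓜) (-polySign 𝓜)

/-- The bracket of `M[t, dt]`:
`[a + dt · b, a' + dt · b'] = [a, a'] + dt · ([b, a'] + (-1)^{deg a} [a, b'])`. -/
def formBracket [DirectSum.Decomposition 𝓜] (B : DGLA 𝓜) :
    (K[X] ⊗[K] M) × (K[X] ⊗[K] M) →ₗ[K] (K[X] ⊗[K] M) × (K[X] ⊗[K] M) →ₗ[K]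
      (K[X] ⊗[K] M) × (K[X] ⊗[K] M) :=
  LinearMap.mk₂ K
    (fun x y => (polyBracket B x.1 y.1,
      polyBracket B x.2 y.1 + polyBracket B (polySign 𝓜 x.1) y.2))
    (fun _ _ _ => by ext <;> simp; abel)
    (fun _ _ _ => by ext <;> simp)
    (fun _ _ _ => by ext <;> simp; abel)
    (fun _ _ _ => by ext <;> simp)

theorem evalAt_polyBracket (B : DGLA 𝓜) (c : K) (a b : K[X] ⊗[K] M) :
    evalAt M c (polyBracket B a b) = B.bracket (evalAt M c a) (evalAt M c b) := by
  induction a with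
  | zero => simp
  | add a a' h h' => simp [h, h']
  | tmul p x =>
    induction b with
    | zero => simp
    | add b b' h h' => simp [h, h']
    | tmul q y =>
      simp [evalAt, polyBracket, Polynomial.leval, mul_smul]
      exact smul_comm _ _ _

theorem evalAt_polySign [DirectSum.Decomposition 𝓜] (c : K) (a : K[X] ⊗[K] M) :
    evalAt M c (polySign 𝓜 a) = gradeSign 𝓜 (evalAt M c a) := by
  induction a with
  | zero => simp
  | add a a' h h' => simp [h, h']
  | tmul p x => simp [evalAt, polySign]

end Forms

/-! ### The mapping cone -/

section Cone

variable {K L M : Type*} [Field K] [AddCommGroup L] [Module K L] [AddCommGroup M] [Module K M]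

/-- The grading of `C_χ[1] = L[1] ⊕ M`: the component of degree `i` is
`C_χ^{i+1} = L^{i+1} ⊕ M^i`. -/
def coneGrading (𝓛 : ℤ → Submodule K L) (𝓜 : ℤ → Submodule K M) (i : ℤ) : Submodule K (L × M) :=
  (𝓛 (i + 1)).prod (𝓜 i)

instance (𝓛 : ℤ → Submodule K L) (𝓜 : ℤ → Submodule K M) [DirectSum.Decomposition 𝓛]
    [DirectSum.Decomposition 𝓜] : DirectSum.Decomposition (coneGrading 𝓛 𝓜) :=
  DirectSum.Decomposition.ofLinearMap _
    (LinearMap.coprod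
      (DirectSum.toModule K ℤ _ (fun i =>
          DirectSum.lof K ℤ (fun i => coneGrading 𝓛 𝓜 i) (i - 1) ∘ₗ
            LinearMap.codRestrict _ (LinearMap.inl K L M ∘ₗ (𝓛 i).subtype)
              (fun x => ⟨by simp, by simp⟩)) ∘ₗ
        (DirectSum.decomposeLinearEquiv 𝓛).toLinearMap)
      (DirectSum.toModule K ℤ _ (fun i =>
          DirectSum.lof K ℤ (fun i => coneGrading 𝓛 𝓜 i) i ∘ₗ
            LinearMap.codRestrict _ (LinearMap.inr K L M ∘ₗ (𝓜 i).subtype)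
              (fun x => ⟨by simp, by simp⟩)) ∘ₗ
        (DirectSum.decomposeLinearEquiv 𝓜).toLinearMap))
    (by
      refine LinearMap.prod_ext ?_ ?_
      · refine DirectSum.decompose_lhom_ext 𝓛 fun i => LinearMap.ext fun x => ?_
        simp [DirectSum.toModule_lof]
        rfl
      · refine DirectSum.decompose_lhom_ext 𝓜 fun i => LinearMap.ext fun x => ?_
        simp [DirectSum.toModule_lof]
        rfl)
    (by
      refine DirectSum.linearMap_ext K fun i => LinearMap.ext fun x => ?_
      obtain ⟨⟨l, m⟩, hl, hm⟩ := x
      have key : ∀ (j k : ℤ) (y : coneGrading 𝓛 𝓜 j) (z : coneGrading 𝓛 𝓜 k), j = k →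
          (y : L × M) = z → DirectSum.lof K ℤ (fun i => coneGrading 𝓛 𝓜 i) j y =
            DirectSum.lof K ℤ (fun i => coneGrading 𝓛 𝓜 i) k z := by
        rintro j k y z rfl h
        rw [Subtype.ext h]
      have el := DirectSum.decomposeLinearEquiv_apply_coe 𝓛 (i + 1) ⟨l, hl⟩
      have em := DirectSum.decomposeLinearEquiv_apply_coe 𝓜 i ⟨m, hm⟩
      simp only at el em
      simp only [LinearMap.comp_apply, DirectSum.coeLinearMap_lof, LinearMap.coprod_apply,
        LinearEquiv.coe_coe, el, em, DirectSum.toModule_lof, LinearMap.id_apply]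
      rw [key (i + 1 - 1) i _ ⟨(l, 0), hl, (𝓜 i).zero_mem⟩ (by omega) rfl, ← map_add]
      congr 1
      refine Subtype.ext (Prod.ext ?_ ?_)
      · exact add_zero l
      · exact zero_add m)

variable {𝓛 : ℤ → Submodule K L} {𝓜 : ℤ → Submodule K M} {A : DGLA 𝓛} {B : DGLA 𝓜}

/-- The differential `δ(l, m) = (dl, χ(l) - dm)` of the suspended mapping cone `C_χ`. -/
def coneDifferential (χ : A.Hom B) : L × M →ₗ[K] L × M :=
  LinearMap.prod (A.d ∘ₗ LinearMap.fst K L M)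
    (χ.toLinearMap ∘ₗ LinearMap.fst K L M - B.d ∘ₗ LinearMap.snd K L M)

/-- `H_χ = {(l, ω) ∈ L × M[t, dt] | e_0(ω) = 0, e_1(ω) = χ(l)}`. -/
def pathSpace (χ : A.Hom B) : Submodule K (L × ((K[X] ⊗[K] M) × (K[X] ⊗[K] M))) where
  carrier := {x | evalAt M 0 x.2.1 = 0 ∧ evalAt M 1 x.2.1 = χ.toLinearMap x.1}
  zero_mem' := by simp
  add_mem' := by
    rintro x y ⟨hx, hx'⟩ ⟨hy, hy'⟩
    exact ⟨by simp [hx, hy], by simp [hx', hy']⟩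
  smul_mem' := by
    rintro c x ⟨hx, hx'⟩
    exact ⟨by simp [hx], by simp [hx']⟩

theorem gradeSign_map [DirectSum.Decomposition 𝓛] [DirectSum.Decomposition 𝓜] (χ : A.Hom B)
    (x : L) : gradeSign 𝓜 (χ.toLinearMap x) = χ.toLinearMap (gradeSign 𝓛 x) := by
  have h : gradeSign 𝓜 ∘ₗ χ.toLinearMap = χ.toLinearMap ∘ₗ gradeSign 𝓛 := by
    refine DirectSum.decompose_lhom_ext 𝓛 fun i => LinearMap.ext fun y => ?_
    simp only [LinearMap.comp_apply, Submodule.subtype_apply]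
    rw [gradeSign_of_mem 𝓛 y.2, gradeSign_of_mem 𝓜 (χ.map_mem y.2)]
    rcases Int.even_or_odd i with h | h
    · simp [Int.negOnePow_even i h]
    · simp [Int.negOnePow_odd i h]
  exact LinearMap.congr_fun h x

/-- The operation `q₂(x ⊙ y) = (-1)^{deg x} [x, y]` on `H_χ[1]`, with the degree and the bracket
of `H_χ ⊆ L × M[t, dt]`. -/
def pathQ₂ [DirectSum.Decomposition 𝓛] [DirectSum.Decomposition 𝓜] (χ : A.Hom B) :
    pathSpace χ →ₗ[K] pathSpace χ →ₗ[K] pathSpace χ :=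
  LinearMap.mk₂ K
    (fun x y => ⟨(A.bracket (gradeSign 𝓛 x.1.1) y.1.1,
        formBracket B (formSign 𝓜 x.1.2) y.1.2), by
      obtain ⟨⟨l, a, b⟩, ha, ha'⟩ := x
      obtain ⟨⟨l', a', b'⟩, hb, hb'⟩ := y
      refine ⟨?_, ?_⟩
      · simp_all [formBracket, formSign, evalAt_polyBracket]
      · simp_all [formBracket, formSign, evalAt_polyBracket, evalAt_polySign, χ.map_bracket,
          gradeSign_map χ]⟩)
    (fun _ _ _ => by ext1; simp)
    (fun _ _ _ => by ext1; simp)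
    (fun _ _ _ => by ext1; simp)
    (fun _ _ _ => by ext1; simp)

/-- `ι(l, m) = (l, t χ(l) + dt · m)`. -/
def pathInclusion (χ : A.Hom B) : L × M →ₗ[K] pathSpace χ :=
  LinearMap.codRestrict _
    (LinearMap.prod (LinearMap.fst K L M)
      (LinearMap.prod (tMul K M ∘ₗ χ.toLinearMap ∘ₗ LinearMap.fst K L M)
        (const K M ∘ₗ LinearMap.snd K L M)))
    (fun x => ⟨by simp [tMul, evalAt, Polynomial.leval], by simp [tMul, evalAt, Polynomial.leval]⟩)

/-- `π(l, ω) = (l, ∫₀¹ ω)`. -/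
def pathProjection (χ : A.Hom B) : pathSpace χ →ₗ[K] L × M :=
  LinearMap.prodMap LinearMap.id (integral01 K M ∘ₗ LinearMap.snd K _ _) ∘ₗ (pathSpace χ).subtype

/-- The homotopy `(l, ω) ↦ (0, ∫₀ᵗ ω - t ∫₀¹ ω)`. -/
def pathHomotopy (χ : A.Hom B) : pathSpace χ →ₗ[K] pathSpace χ :=
  LinearMap.codRestrict _
    (LinearMap.inr K L _ ∘ₗ LinearMap.inl K (K[X] ⊗[K] M) (K[X] ⊗[K] M) ∘ₗ
      (integral K M - tMul K M ∘ₗ integral01 K M) ∘ₗ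
        LinearMap.snd K _ _ ∘ₗ LinearMap.snd K _ _ ∘ₗ (pathSpace χ).subtype)
    (fun x => by
      have h (z : K[X] ⊗[K] M) : evalAt M 0 (integral K M z) = 0 := by
        induction z with
        | zero => simp
        | add a b h h' => simp [h, h']
        | tmul p y =>
          induction p using Polynomial.induction_on' with
          | add p q h h' => simp [TensorProduct.add_tmul, h, h']
          | monomial n c => simp [evalAt, integral, polyIntegral, Polynomial.leval]
      have h0 (y : M) : evalAt M (0 : K) (Polynomial.X ⊗ₜ[K] y) = 0 := by
        simp [evalAt, Polynomial.leval]
      exact ⟨by simp [h, h0, tMul],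
        by simp [integral01, tMul, evalAt, Polynomial.leval]⟩)

/-- The brackets `⟨ ⟩_n : ⨀ⁿ C_χ[1] → C_χ[1]` of `C̃(χ)`, obtained by homotopy transfer from the
differential graded Lie algebra `H_χ`; the suspended differential is `-δ`. -/
def coneBracket [DirectSum.Decomposition 𝓛] [DirectSum.Decomposition 𝓜] (χ : A.Hom B) :
    ∀ n : ℕ, MultilinearMap K (fun _ : Fin n => L × M) (L × M) :=
  transferBracket (W := pathSpace χ) (coneGrading 𝓛 𝓜) (pathQ₂ χ) (pathInclusion χ) (pathHomotopy χ)
    (pathProjection χ) (-coneDifferential χ)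

end Cone

/-- `[x_1, [x_2, …, [x_n, y] … ]]`. -/
def nestedBracket {K M : Type*} [Field K] [AddCommGroup M] [Module K M]
    {𝓜 : ℤ → Submodule K M} (B : DGLA 𝓜) {n : ℕ} (x : Fin n → M) (y : M) : M :=
  (List.ofFn x).foldr (fun a b => B.bracket a b) y

end ConeLInfinity

end

noncomputable section

namespace ConeLInfinity

/-! The suspended path space `W = H_χ[1]`, with its operations `q₁` and `q₂`, contracts onto the
shifted cone: `ι` and `π` are chain maps and `q₁ H + H q₁ = ι π - 1`. On `M[t, dt]` the last
identity is the fundamental theorem of calculus together with the endpoint conditions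
(`isTransferDatum_pathSpace`). The `L_∞` half of the theorem holds for any such datum.

Write `F` for the components of `ι_∞` and `b` for the brackets, as functions of a finite set `S` of
arguments, and let `(X * Y)(S)` be the signed sum of `q₂ (X P) (Y (S \ P))` over `P ⊆ S`. With `Q =
½ F * F`, the recursion says that `F` is `ι` in arity one plus `H Q`, and that `b` is `δ₁` in arity
one plus `π Q`. The Leibniz and Jacobi identities give `(q₁ F + Q) * F = -q₁ Q`
(`starProduct_curvature`). Let `F∘b` and `b∘b` be the composites with the coderivation induced by
`b`. Expanding `Q` yields `F∘b = ι b + H ((F∘b) * F)` (`sum_cons_eq`), so induction on `S` and the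
homotopy identity give `F∘b = q₁ F + Q`: `ι_∞` is an `L_∞` morphism (`sum_transferMap_cons`). The
same expansion gives `b∘b = δ₁ b - π q₁ Q = 0` (`sum_transferBracket_cons`).

For the explicit brackets, only the `L` part and the `dt` part of `Q` matter, since `π` and `H` see
nothing else. The values of `H` have no `L` or `dt` part, so a product of two of them contributes
nothing, and each term of the recursion splits off a single argument (`map_transferQuadratic_succ`).
An argument from `L` contributes nothing when split off in arity at least three; an argument `m`
applies `[m, -]` to the polynomial part. Starting from `t χ(l)`, this produces nested brackets whose
polynomial coefficients satisfy `P_1 = t`, `P_{n+1} = ∫₀ᵗ P_n - t ∫₀¹ P_n`. The solution is `P_n =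
(B_n(t) - B_n) / n!`, and `∫₀¹ P_n = -B_n / n!` is the coefficient of the bracket
(`pathResidue_pathQuadratic_snoc`). -/

/-! ### Koszul signs of pairs of finite sets -/

section CrossSign

variable {I J : Type*} [LinearOrder I] [LinearOrder J]

/-- The Koszul sign of `v_S = ± v_P ⊙ v_R` for a partition `S = P ⊔ R`: every pair `i ∈ P`, `j ∈ R`
with `j < i` contributes `(-1)` to the product of the degrees. -/
def crossSign (d : I → ℤ) (P R : Finset I) : ℤˣ :=
  ∏ i ∈ P, ∏ j ∈ R, if j < i then (d i * d j).negOnePow else 1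

theorem negOnePow_sum {α : Type*} (s : Finset α) (f : α → ℤ) :
    (∑ i ∈ s, f i).negOnePow = ∏ i ∈ s, (f i).negOnePow := by
  classical
  induction s using Finset.induction_on with
  | empty => simp
  | insert a s h ih => rw [Finset.sum_insert h, Finset.prod_insert h, Int.negOnePow_add, ih]

@[simp]
theorem crossSign_empty_left (d : I → ℤ) (R : Finset I) : crossSign d ∅ R = 1 := by
  simp [crossSign]

@[simp]
theorem crossSign_empty_right (d : I → ℤ) (P : Finset I) : crossSign d P ∅ = 1 := by
  simp [crossSign]

theorem crossSign_union_left (d : I → ℤ) {P U : Finset I} (h : Disjoint P U) (R : Finset I) :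
    crossSign d (P ∪ U) R = crossSign d P R * crossSign d U R := by
  simp [crossSign, Finset.prod_union h]

theorem crossSign_union_right (d : I → ℤ) (P : Finset I) {R U : Finset I} (h : Disjoint R U) :
    crossSign d P (R ∪ U) = crossSign d P R * crossSign d P U := by
  simp [crossSign, Finset.prod_union h, Finset.prod_mul_distrib]

/-- Each pair in `P × R` is inverted in exactly one of the two orders, so the two signs together
account for every pair once. -/
theorem crossSign_comm (d : I → ℤ) {P R : Finset I} (h : Disjoint P R) :
    crossSign d P R = ((∑ i ∈ P, d i) * ∑ i ∈ R, d i).negOnePow * crossSign d R P := by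
  have e : ((∑ i ∈ P, d i) * ∑ i ∈ R, d i).negOnePow =
      ∏ i ∈ P, ∏ j ∈ R, (d i * d j).negOnePow := by
    rw [Finset.sum_mul_sum, negOnePow_sum]
    simp [negOnePow_sum]
  have e' : crossSign d R P = ∏ i ∈ P, ∏ j ∈ R, if i < j then (d i * d j).negOnePow else 1 := by
    rw [crossSign, Finset.prod_comm]
    simp [mul_comm]
  rw [e, e', crossSign, ← Finset.prod_mul_distrib]
  refine Finset.prod_congr rfl fun i hi => ?_
  rw [← Finset.prod_mul_distrib]
  refine Finset.prod_congr rfl fun j hj => ?_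
  have hij : i ≠ j := fun hh => Finset.disjoint_left.1 h hi (hh ▸ hj)
  rcases lt_or_gt_of_ne hij with h1 | h1
  · simp [h1, h1.not_gt]
  · simp [h1, h1.not_gt]

theorem crossSign_map (d : I → ℤ) (e : J ↪ I) (he : StrictMono e) (P R : Finset J) :
    crossSign d (P.map e) (R.map e) = crossSign (d ∘ e) P R := by
  simp [crossSign, Finset.prod_map, he.lt_iff_lt]

theorem crossSign_insert_bot (d : I → ℤ) {a : I} {P R : Finset I} (hR : ∀ j ∈ R, a < j)
    (ha : a ∉ P) : crossSign d (insert a P) R = crossSign d P R := by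
  rw [crossSign, Finset.prod_insert ha, Finset.prod_eq_one, one_mul]
  · rfl
  · intro j hj
    rw [if_neg (hR j hj).not_gt]

/-- The Koszul sign of the restriction to `P` of a reordering `w : J → I`. -/
def inversionSign (w : J → I) (d : I → ℤ) (P : Finset J) : ℤˣ :=
  ∏ i ∈ P, ∏ j ∈ P, if i < j ∧ w j < w i then (d (w i) * d (w j)).negOnePow else 1

/-- Only the mixed pairs need comparison: a pair from `P × R` changes its relative order under `w`
exactly when it contributes to one of the two cross signs and not to the other. -/
theorem inversionSign_union_mul (w : J ↪ I) (d : I → ℤ) {P R : Finset J} (h : Disjoint P R) :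
    inversionSign w d (P ∪ R) * crossSign (d ∘ w) P R =
      inversionSign w d P * inversionSign w d R * crossSign d (P.map w) (R.map w) := by
  have e : inversionSign w d (P ∪ R) = inversionSign w d P * inversionSign w d R *
      ∏ i ∈ P, ∏ j ∈ R, ((if i < j ∧ w j < w i then (d (w i) * d (w j)).negOnePow else 1) *
        if j < i ∧ w i < w j then (d (w i) * d (w j)).negOnePow else 1) := by
    simp only [inversionSign, Finset.prod_union h, Finset.prod_mul_distrib]
    rw [Finset.prod_comm (s := R) (t := P)]
    simp only [mul_comm (d (w _)) (d (w _))]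
    have : ∀ a b c e : ℤˣ, a * b * (c * e) = a * e * (b * c) := fun a b c e => by
      rw [mul_assoc, mul_assoc, mul_comm e, ← mul_assoc b]
    exact this _ _ _ _
  rw [e, mul_assoc]
  congr 1
  simp only [crossSign, Finset.prod_map, ← Finset.prod_mul_distrib, Function.comp_apply]
  refine Finset.prod_congr rfl fun i hi => Finset.prod_congr rfl fun j hj => ?_
  have hij : i ≠ j := fun hh => Finset.disjoint_left.1 h hi (hh ▸ hj)
  have hw : w i ≠ w j := fun hh => hij (w.injective hh)
  have hs : ∀ m : ℤ, m.negOnePow * m.negOnePow = 1 := fun m => by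
    rw [← Int.negOnePow_add, ← two_mul, Int.negOnePow_two_mul]
  rcases lt_or_gt_of_ne hij with h1 | h1 <;> rcases lt_or_gt_of_ne hw with h2 | h2 <;>
    simp [h1, h1.not_gt, h2, h2.not_gt, hs]

end CrossSign

/-! ### Sums over unshuffles -/

section Unshuffles

theorem mem_unshuffles {p n : ℕ} {σ : Equiv.Perm (Fin n)} : σ ∈ unshuffles p n ↔
    ∀ i j : Fin n, i < j → ((j : ℕ) < p ∨ p ≤ (i : ℕ)) → σ i < σ j := by
  simp [unshuffles]

/-- The image of the first `p` places. -/
def firstPlaces {n : ℕ} (p : ℕ) (σ : Equiv.Perm (Fin n)) : Finset (Fin n) :=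
  {x | (σ.symm x : ℕ) < p}

theorem apply_mem_firstPlaces {p n : ℕ} {σ : Equiv.Perm (Fin n)} {i : Fin n} :
    σ i ∈ firstPlaces p σ ↔ (i : ℕ) < p := by
  simp [firstPlaces]

theorem card_firstPlaces {p n : ℕ} (hp : p ≤ n) (σ : Equiv.Perm (Fin n)) :
    (firstPlaces p σ).card = p := by
  have : firstPlaces p σ = (Finset.univ.filter fun i : Fin n => (i : ℕ) < p).map σ.toEmbedding := by
    ext x
    simp [firstPlaces]
  rw [this, Finset.card_map, Fin.card_filter_val_lt, min_eq_right hp]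

/-- An unshuffle is increasing on each block, so every inversion pairs a place of the first block
with one of the second. -/
theorem koszulSign_unshuffle {p n : ℕ} {σ : Equiv.Perm (Fin n)} (hσ : σ ∈ unshuffles p n)
    (d : Fin n → ℤ) :
    koszulSign σ d = crossSign d (firstPlaces p σ) (firstPlaces p σ)ᶜ := by
  have e : crossSign d (firstPlaces p σ) (firstPlaces p σ)ᶜ =
      ∏ i, ∏ j, if i ∈ firstPlaces p σ ∧ j ∉ firstPlaces p σ ∧ j < i then
        (d i * d j).negOnePow else 1 := by
    rw [crossSign, ← Finset.prod_filter_mul_prod_filter_not Finset.univ (· ∈ firstPlaces p σ)]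
    rw [Finset.filter_mem_eq_inter, Finset.univ_inter]
    rw [Finset.prod_eq_one (s := Finset.univ.filter (· ∉ firstPlaces p σ)), mul_one]
    · refine Finset.prod_congr rfl fun i hi => ?_
      rw [Finset.prod_congr_of_eq_on_inter (s₁ := (firstPlaces p σ)ᶜ) (s₂ := Finset.univ)
        (g := fun j => if i ∈ firstPlaces p σ ∧ j ∉ firstPlaces p σ ∧ j < i then
        (d i * d j).negOnePow else 1)]
      · intro j _ hj
        exact absurd (Finset.mem_univ _) hj
      · intro j _ hj
        rw [if_neg]
        simp_all
      · intro j hj _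
        simp_all
    · intro i hi
      refine Finset.prod_eq_one fun j _ => if_neg ?_
      simp_all
  rw [e, ← Equiv.prod_comp σ]
  refine Finset.prod_congr rfl fun i _ => ?_
  refine Eq.trans ?_ (Equiv.prod_comp σ _)
  refine Finset.prod_congr rfl fun j _ => ?_
  refine if_congr ?_ rfl rfl
  rw [apply_mem_firstPlaces, apply_mem_firstPlaces]
  have := mem_unshuffles.1 hσ i j
  have hji := mem_unshuffles.1 hσ j i
  constructor
  · rintro ⟨h1, h2⟩
    have h3 : ¬ ((j : ℕ) < p ∨ p ≤ (i : ℕ)) := fun h => lt_asymm h2 (this h1 h)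
    rw [not_or, not_le] at h3
    exact ⟨h3.2, h3.1, h2⟩
  · rintro ⟨h1, h2, h3⟩
    exact ⟨by rw [Fin.lt_def]; omega, h3⟩

theorem ofFn_first_eq_sort {p n : ℕ} (hp : p ≤ n) {σ : Equiv.Perm (Fin n)}
    (hσ : σ ∈ unshuffles p n) :
    List.ofFn (fun i : Fin p => σ ⟨i, by omega⟩) = (firstPlaces p σ).sort := by
  refine List.SortedLT.eq_of_mem_iff (StrictMono.sortedLT_ofFn fun i j h => ?_)
    (Finset.sortedLT_sort _) fun a => ?_
  · exact mem_unshuffles.1 hσ _ _ h (Or.inl j.2)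
  · rw [Finset.mem_sort, List.mem_ofFn]
    constructor
    · rintro ⟨i, rfl⟩
      exact apply_mem_firstPlaces.2 i.2
    · intro h
      refine ⟨⟨σ.symm a, by simpa [firstPlaces] using h⟩, ?_⟩
      exact σ.apply_symm_apply a

theorem ofFn_last_eq_sort {p n : ℕ} (hp : p ≤ n) {σ : Equiv.Perm (Fin n)}
    (hσ : σ ∈ unshuffles p n) :
    List.ofFn (fun j : Fin (n - p) => σ ⟨p + j, by omega⟩) = (firstPlaces p σ)ᶜ.sort := by
  refine List.SortedLT.eq_of_mem_iff (StrictMono.sortedLT_ofFn fun i j h => ?_)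
    (Finset.sortedLT_sort _) fun a => ?_
  · refine mem_unshuffles.1 hσ _ _ ?_ (Or.inr ?_)
    · exact Nat.add_lt_add_left h p
    · exact Nat.le_add_right p i
  · rw [Finset.mem_sort, List.mem_ofFn, Finset.mem_compl]
    constructor
    · rintro ⟨i, rfl⟩
      rw [apply_mem_firstPlaces]
      exact (Nat.le_add_right p i).not_gt
    · intro h
      have h' : p ≤ (σ.symm a : ℕ) := by simpa [firstPlaces] using h
      refine ⟨⟨σ.symm a - p, by omega⟩, ?_⟩
      have : (⟨p + ((σ.symm a : ℕ) - p), by omega⟩ : Fin n) = σ.symm a := Fin.ext (by simp; omega)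
      simp [this]

/-- An unshuffle is determined by the set of its first `p` values. From here on sums over
permutations are replaced by sums over subsets, where iterated sums are easy to reindex. -/
theorem sum_unshuffles {W : Type*} [AddCommGroup W] {p n : ℕ} (hp : p ≤ n) (d : Fin n → ℤ)
    (Φ : List (Fin n) → List (Fin n) → W) :
    ∑ σ ∈ unshuffles p n, koszulSign σ d •
        Φ (List.ofFn fun i : Fin p => σ ⟨i, by omega⟩)
          (List.ofFn fun j : Fin (n - p) => σ ⟨p + j, by omega⟩) =
      ∑ P ∈ Finset.univ.powersetCard p, crossSign d P Pᶜ • Φ P.sort Pᶜ.sort := by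
  refine Finset.sum_bij (fun σ _ => firstPlaces p σ) ?_ ?_ ?_ ?_
  · intro σ _
    exact Finset.mem_powersetCard.2 ⟨Finset.subset_univ _, card_firstPlaces hp σ⟩
  · intro σ hσ τ hτ h
    have h1 := ofFn_first_eq_sort hp hσ
    have h2 := ofFn_last_eq_sort hp hσ
    rw [h, ← ofFn_first_eq_sort hp hτ] at h1
    rw [h, ← ofFn_last_eq_sort hp hτ] at h2
    have h1 := List.ofFn_injective h1
    have h2 := List.ofFn_injective h2
    ext i
    rcases lt_or_ge (i : ℕ) p with hi | hi
    · exact congrArg Fin.val (congrFun h1 ⟨i, hi⟩)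
    · have := congrArg Fin.val (congrFun h2 ⟨i - p, by omega⟩)
      have e : (⟨p + ((i : ℕ) - p), by omega⟩ : Fin n) = i := Fin.ext (by simp; omega)
      simpa only [e] using this
  · intro P hP
    have hc : P.card = p := (Finset.mem_powersetCard.1 hP).2
    have hc' : Pᶜ.card = n - p := by rw [Finset.card_compl, hc, Fintype.card_fin]
    -- The unshuffle belonging to `P` lists `P` increasingly and then its complement increasingly.
    let σ : Equiv.Perm (Fin n) := (finCongr (show n = p + (n - p) by omega)).trans
      (finSumFinEquiv.symm.trans (finSumEquivOfFinset hc hc'))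
    have hl : ∀ i : Fin n, ∀ h : (i : ℕ) < p, σ i = P.orderEmbOfFin hc ⟨i, h⟩ := by
      intro i h
      have : finCongr (show n = p + (n - p) by omega) i = Fin.castAdd _ ⟨i, h⟩ := by
        ext; simp
      simp only [σ, Equiv.trans_apply, this, finSumFinEquiv_symm_apply_castAdd,
        finSumEquivOfFinset_inl]
    have hr : ∀ i : Fin n, ∀ h : p ≤ (i : ℕ), σ i = Pᶜ.orderEmbOfFin hc' ⟨i - p, by omega⟩ := by
      intro i h
      have : finCongr (show n = p + (n - p) by omega) i = Fin.natAdd _ ⟨i - p, by omega⟩ := by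
        ext; simp; omega
      simp only [σ, Equiv.trans_apply, this, finSumFinEquiv_symm_apply_natAdd,
        finSumEquivOfFinset_inr]
    refine ⟨σ, mem_unshuffles.2 fun i j hij h => ?_, ?_⟩
    · rcases h with h | h
      · rw [hl i (by omega), hl j h]
        exact (OrderEmbedding.lt_iff_lt _).2 hij
      · rw [hr i h, hr j (by omega)]
        refine (OrderEmbedding.lt_iff_lt _).2 ?_
        rw [Fin.lt_def] at hij ⊢
        simp only
        omega
    · refine Finset.eq_of_subset_of_card_le (fun a ha => ?_) (by rw [hc, card_firstPlaces hp])
      obtain ⟨i, rfl⟩ := σ.surjective a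
      rw [apply_mem_firstPlaces] at ha
      rw [hl i ha]
      exact Finset.orderEmbOfFin_mem _ _ _
  · intro σ hσ
    rw [koszulSign_unshuffle hσ, ofFn_first_eq_sort hp hσ, ofFn_last_eq_sort hp hσ]

end Unshuffles

/-! ### Partitions of finite sets into two and three parts -/

section Partitions

variable {I W : Type*} [DecidableEq I] [AddCommMonoid W]

theorem sum_powerset_compl (S : Finset I) (g : Finset I → Finset I → W) :
    ∑ P ∈ S.powerset, g P (S \ P) = ∑ P ∈ S.powerset, g (S \ P) P := by
  refine Finset.sum_nbij' (S \ ·) (S \ ·) ?_ ?_ ?_ ?_ ?_ <;> intro P hP <;>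
    rw [Finset.mem_powerset] at hP
  · simp
  · simp
  · simp [hP]
  · simp [hP]
  · simp [hP]

omit [DecidableEq I] in
theorem sum_powerset_map {J : Type*} (e : J ↪ I) (S : Finset J) (g : Finset I → W) :
    ∑ R ∈ (S.map e).powerset, g R = ∑ P ∈ S.powerset, g (P.map e) := by
  refine (Finset.sum_bij (fun P _ => P.map e) ?_ ?_ ?_ fun _ _ => rfl).symm
  · intro P hP
    exact Finset.mem_powerset.2 (Finset.map_subset_map.2 (Finset.mem_powerset.1 hP))
  · intro P _ R _ h
    exact Finset.map_injective _ h
  · intro R hR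
    obtain ⟨P, hP, rfl⟩ := Finset.subset_map_iff.1 (Finset.mem_powerset.1 hR)
    exact ⟨P, Finset.mem_powerset.2 hP, rfl⟩

/-- Both sides run over the ordered partitions of `S` into three parts; on the right `X` is the
union of the first two. -/
theorem sum_powerset_powerset (S : Finset I) (g : Finset I → Finset I → Finset I → W) :
    ∑ P ∈ S.powerset, ∑ U ∈ (S \ P).powerset, g P U ((S \ P) \ U) =
      ∑ X ∈ S.powerset, ∑ P ∈ X.powerset, g P (X \ P) (S \ X) := by
  rw [Finset.sum_sigma', Finset.sum_sigma']
  refine Finset.sum_nbij' (fun x => ⟨x.1 ∪ x.2, x.1⟩) (fun x => ⟨x.2, x.1 \ x.2⟩) ?_ ?_ ?_ ?_ ?_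
  · rintro ⟨P, U⟩ h
    simp only [Finset.mem_sigma, Finset.mem_powerset] at h ⊢
    exact ⟨Finset.union_subset h.1 (h.2.trans Finset.sdiff_subset), Finset.subset_union_left⟩
  · rintro ⟨X, P⟩ h
    simp only [Finset.mem_sigma, Finset.mem_powerset] at h ⊢
    exact ⟨h.2.trans h.1, Finset.sdiff_subset_sdiff h.1 le_rfl⟩
  · rintro ⟨P, U⟩ h
    simp only [Finset.mem_sigma, Finset.mem_powerset] at h ⊢
    have : Disjoint U P := Finset.disjoint_of_subset_left h.2 Finset.sdiff_disjoint
    simp [Finset.union_sdiff_left, this]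
  · rintro ⟨X, P⟩ h
    simp only [Finset.mem_sigma, Finset.mem_powerset] at h ⊢
    simp [Finset.union_sdiff_of_subset h.2]
  · rintro ⟨P, U⟩ h
    simp only [Finset.mem_sigma, Finset.mem_powerset] at h ⊢
    have : Disjoint U P := Finset.disjoint_of_subset_left h.2 Finset.sdiff_disjoint
    rw [Finset.union_sdiff_left, Finset.sdiff_eq_self_of_disjoint this, Finset.sdiff_sdiff_left']
    congr 1
    ext; simp; tauto

theorem sum_powerset_powerset_rotate (S : Finset I) (g : Finset I → Finset I → Finset I → W) :
    ∑ X ∈ S.powerset, ∑ P ∈ X.powerset, g P (X \ P) (S \ X) =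
      ∑ X ∈ S.powerset, ∑ P ∈ X.powerset, g (X \ P) (S \ X) P := by
  rw [← sum_powerset_powerset S fun P U Z => g U Z P,
    sum_powerset_compl S fun X Z => ∑ P ∈ X.powerset, g P (X \ P) Z]

end Partitions

/-! ### Multilinear maps evaluated on lists -/

section OnList

variable {K V W I : Type*} [Field K] [AddCommGroup V] [Module K V] [AddCommGroup W] [Module K W]
  [LinearOrder I]

/-- The value of a family of multilinear maps on a list of vectors. -/
def onList (f : ∀ n : ℕ, MultilinearMap K (fun _ : Fin n => V) W) (l : List V) : W :=
  f l.length l.get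

/-- On lists the arity is read off from the argument, so no transport between `Fin n` and `Fin n'`
for equal `n` and `n'` is needed later. -/
theorem onList_ofFn (f : ∀ n : ℕ, MultilinearMap K (fun _ : Fin n => V) W) {n : ℕ}
    (v : Fin n → V) : onList f (List.ofFn v) = f n v := by
  have key : ∀ (l : List V) (h : l.length = n),
      onList f l = f n fun i => l.get (i.cast h.symm) := by
    rintro l rfl
    rfl
  rw [key _ (List.length_ofFn)]
  congr 1
  funext i
  simp

theorem onList_cons (f : ∀ n : ℕ, MultilinearMap K (fun _ : Fin n => V) W) {n : ℕ}
    (x : V) (v : Fin n → V) : onList f (x :: List.ofFn v) = f (n + 1) (Fin.cons x v) := by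
  rw [← onList_ofFn, List.ofFn_succ]
  simp

theorem onList_zero_cons (f : ∀ n : ℕ, MultilinearMap K (fun _ : Fin n => V) W) (l : List V) :
    onList f (0 :: l) = 0 :=
  (f (l.length + 1)).map_coord_zero 0 rfl

/-- The value on the vectors `v i`, `i ∈ S`, in increasing order. -/
def onFinset (f : ∀ n : ℕ, MultilinearMap K (fun _ : Fin n => V) W) (v : I → V)
    (S : Finset I) : W :=
  onList f (S.sort.map v)

theorem onFinset_empty (f : ∀ n : ℕ, MultilinearMap K (fun _ : Fin n => V) W) (hf : f 0 = 0)
    (v : I → V) : onFinset f v ∅ = 0 := by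
  rw [onFinset, Finset.sort_empty, List.map_nil, ← List.ofFn_zero (f := Fin.elim0), onList_ofFn, hf]
  rfl

theorem onFinset_univ (f : ∀ n : ℕ, MultilinearMap K (fun _ : Fin n => V) W) {n : ℕ}
    (v : Fin n → V) : onFinset f v Finset.univ = f n v := by
  rw [onFinset, Fin.sort_univ, ← List.ofFn_eq_map, onList_ofFn]

theorem onFinset_eq (f : ∀ n : ℕ, MultilinearMap K (fun _ : Fin n => V) W) (v : I → V)
    {S : Finset I} {n : ℕ} (h : S.card = n) :
    onFinset f v S = f n (v ∘ S.orderEmbOfFin h) := by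
  rw [onFinset, ← Finset.listMap_orderEmbOfFin_finRange S h, List.map_map, ← List.ofFn_eq_map,
    onList_ofFn]

theorem onFinset_map {J : Type*} [LinearOrder J]
    (f : ∀ n : ℕ, MultilinearMap K (fun _ : Fin n => V) W) (v : I → V) (e : J ↪ I)
    (he : StrictMono e) (S : Finset J) : onFinset f v (S.map e) = onFinset f (v ∘ e) S := by
  rw [onFinset, ← (he.strictMonoOn _).map_finsetSort, List.map_map]
  rfl

theorem onFinset_insert_bot (f : ∀ n : ℕ, MultilinearMap K (fun _ : Fin n => V) W) (v : I → V)
    {a : I} {S : Finset I} (h : ∀ j ∈ S, a < j) :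
    onFinset f v (insert a S) = onList f (v a :: S.sort.map v) := by
  rw [onFinset, Finset.sort_insert _ (fun b hb => (h b hb).le) (fun ha => lt_irrefl _ (h a ha)),
    List.map_cons]

theorem onFinset_singleton (f : ∀ n : ℕ, MultilinearMap K (fun _ : Fin n => V) W) (v : I → V)
    (i : I) : onFinset f v {i} = f 1 fun _ => v i := by
  rw [onFinset, Finset.sort_singleton, List.map_singleton,
    show [v i] = List.ofFn fun _ : Fin 1 => v i by simp, onList_ofFn]

end OnList

/-! ### Homogeneous arguments -/

section Homogeneous

variable {K V W : Type*} [Field K] [AddCommGroup V] [Module K V] [AddCommGroup W] [Module K W]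

theorem multilinearMap_ext_homogeneous (𝓥 : ℤ → Submodule K V) [DirectSum.Decomposition 𝓥] {n : ℕ}
    {f g : MultilinearMap K (fun _ : Fin n => V) W}
    (h : ∀ (d : Fin n → ℤ) (v : Fin n → V), (∀ i, v i ∈ 𝓥 (d i)) → f v = g v) : f = g := by
  classical
  ext v
  have e : v = fun i => ∑ j ∈ (DirectSum.decompose 𝓥 (v i)).support,
      (DirectSum.decompose 𝓥 (v i) j : V) := by
    funext i
    exact (DirectSum.sum_support_decompose 𝓥 (v i)).symm
  rw [e, f.map_sum_finset, g.map_sum_finset]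
  exact Finset.sum_congr rfl fun r _ => h r _ fun i => Subtype.coe_prop _

theorem negOnePow_congr {a b : ℤ} (h : (a : ZMod 2) = b) : a.negOnePow = b.negOnePow := by
  rw [Int.negOnePow_eq_iff, even_iff_two_dvd]
  have := (ZMod.intCast_zmod_eq_zero_iff_dvd (a - b) 2).1 (by push_cast; rw [h, sub_self])
  exact_mod_cast this

theorem koszulSign_congr {n : ℕ} (σ : Equiv.Perm (Fin n)) {d d' : Fin n → ℤ}
    (h : ∀ i, (d i : ZMod 2) = d' i) : koszulSign σ d = koszulSign σ d' := by
  refine Finset.prod_congr rfl fun i _ => Finset.prod_congr rfl fun j _ => ?_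
  split_ifs
  · exact negOnePow_congr (by push_cast; rw [h, h])
  · rfl

/-- For homogeneous arguments only the summand with `e i` the parity of `d i` survives. -/
theorem koszulAct_apply (𝓥 : ℤ → Submodule K V) [DirectSum.Decomposition 𝓥] {n : ℕ}
    (σ : Equiv.Perm (Fin n)) (f : MultilinearMap K (fun _ : Fin n => V) W) {d : Fin n → ℤ}
    {v : Fin n → V} (hv : ∀ i, v i ∈ 𝓥 (d i)) :
    koszulAct 𝓥 σ f v = koszulSign σ d • f fun i => v (σ i) := by
  rw [koszulAct, sum_apply, Finset.sum_eq_single fun i => (d i : ZMod 2)]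
  · simp only [smul_apply, MultilinearMap.compLinearMap_apply,
      MultilinearMap.domDomCongr_apply]
    have e1 : (fun i => parityProj 𝓥 (d (σ i) : ZMod 2) (v (σ i))) = fun i => v (σ i) := by
      funext i
      rw [parityProj_of_mem 𝓥 _ (hv _), if_pos rfl]
    rw [e1, koszulSign_congr σ (d := fun i => (((d i : ZMod 2).val : ℕ) : ℤ)) (d' := d)]
    · rw [Int.cast_smul_eq_zsmul, Units.smul_def]
    · intro i
      simp
  · intro e _ he
    obtain ⟨i, hi⟩ := Function.ne_iff.1 he
    rw [smul_apply, MultilinearMap.compLinearMap_apply]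
    rw [MultilinearMap.domDomCongr_apply, MultilinearMap.map_coord_zero _ (σ.symm i), smul_zero]
    simp only [Equiv.apply_symm_apply]
    rw [parityProj_of_mem 𝓥 _ (hv i), if_neg (Ne.symm hi)]
  · intro h
    exact absurd (Finset.mem_univ _) h

theorem pairing_apply (q : W →ₗ[K] W →ₗ[K] W) {a b n : ℕ}
    (h : a + b = n) (f : MultilinearMap K (fun _ : Fin a => V) W)
    (g : MultilinearMap K (fun _ : Fin b => V) W) (v : Fin n → V) :
    pairing q h f g v = q (f fun i => v ⟨i, by omega⟩) (g fun j => v ⟨a + j, by omega⟩) := by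
  simp only [pairing, MultilinearMap.domDomCongr_apply, LinearMap.compMultilinearMap_apply,
    MultilinearMap.domCoprod_apply, TensorProduct.lift.tmul]
  rfl

end Homogeneous

/-! ### The quadratic part of a morphism of coalgebras -/

section Quadratic

variable {K C W : Type*} [Field K] [AddCommGroup C] [Module K C] [AddCommGroup W] [Module K W]

/-- The sum may be extended to all subsets, because the terms of `∅` and of the full set contain a
factor `f 0 = 0`. -/
theorem quadraticPart_apply (𝓒 : ℤ → Submodule K C) [DirectSum.Decomposition 𝓒]
    (q₂ : W →ₗ[K] W →ₗ[K] W) (f : ∀ n : ℕ, MultilinearMap K (fun _ : Fin n => C) W) (hf : f 0 = 0)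
    {n : ℕ} {d : Fin n → ℤ} {v : Fin n → C} (hv : ∀ i, v i ∈ 𝓒 (d i)) :
    quadraticPart 𝓒 q₂ n (fun k _ => f k) v = (2⁻¹ : K) • ∑ P : Finset (Fin n),
      crossSign d P Pᶜ • q₂ (onFinset f v P) (onFinset f v Pᶜ) := by
  have e0 : ∀ P : Finset (Fin n), P.card = 0 →
      crossSign d P Pᶜ • q₂ (onFinset f v P) (onFinset f v Pᶜ) = 0 := by
    intro P hP
    rw [Finset.card_eq_zero.1 hP, onFinset_empty f hf]
    simp
  have e1 : ∀ P : Finset (Fin n), P.card = n →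
      crossSign d P Pᶜ • q₂ (onFinset f v P) (onFinset f v Pᶜ) = 0 := by
    intro P hP
    have : P = Finset.univ := Finset.eq_univ_of_card P (by rw [hP, Fintype.card_fin])
    rw [this, Finset.compl_univ, onFinset_empty f hf]
    simp
  rw [quadraticPart, smul_apply, sum_apply, ← Finset.powerset_univ,
    Finset.sum_powerset, Finset.card_univ, Fintype.card_fin]
  congr 1
  have e2 : ∀ p : Fin (n - 1), (∑ σ ∈ unshuffles (p + 1) n,
      koszulAct 𝓒 σ (pairing q₂ (show (p + 1 : ℕ) + (n - (p + 1)) = n by omega)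
        (f (p + 1)) (f (n - (p + 1))))) v =
      ∑ P ∈ Finset.univ.powersetCard (p + 1),
        crossSign d P Pᶜ • q₂ (onFinset f v P) (onFinset f v Pᶜ) := by
    intro p
    rw [sum_apply]
    unfold onFinset
    rw [← sum_unshuffles (by omega : (p + 1 : ℕ) ≤ n) d
      (fun l l' => q₂ (onList f (l.map v)) (onList f (l'.map v)))]
    refine Finset.sum_congr rfl fun σ _ => ?_
    rw [koszulAct_apply 𝓒 σ _ hv, pairing_apply, List.map_ofFn, List.map_ofFn, onList_ofFn,
      onList_ofFn]
    rfl
  simp only [e2]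
  rcases n with _ | n
  · simp only [zero_add, Finset.sum_range_one]
    rw [Finset.sum_eq_zero (s := Finset.powersetCard 0 _)]
    · rfl
    · intro P hP
      exact e0 P (Finset.mem_powersetCard.1 hP).2
  · rw [Finset.sum_range_succ, Finset.sum_range_succ', Finset.sum_range]
    rw [Finset.sum_eq_zero (s := Finset.powersetCard 0 _), Finset.sum_eq_zero
      (s := Finset.powersetCard (n + 1) _), add_zero, add_zero]
    · rfl
    · intro P hP
      exact e1 P (Finset.mem_powersetCard.1 hP).2
    · intro P hP
      exact e0 P (Finset.mem_powersetCard.1 hP).2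

theorem onFinset_quadraticPart {I : Type*} [LinearOrder I] (𝓒 : ℤ → Submodule K C)
    [DirectSum.Decomposition 𝓒] (q₂ : W →ₗ[K] W →ₗ[K] W)
    (f : ∀ n : ℕ, MultilinearMap K (fun _ : Fin n => C) W) (hf : f 0 = 0)
    {d : I → ℤ} {v : I → C} {S : Finset I} (hv : ∀ i ∈ S, v i ∈ 𝓒 (d i)) :
    onFinset (fun n => quadraticPart 𝓒 q₂ n (fun k _ => f k)) v S = (2⁻¹ : K) •
      ∑ P ∈ S.powerset, crossSign d P (S \ P) • q₂ (onFinset f v P) (onFinset f v (S \ P)) := by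
  set e := S.orderEmbOfFin rfl with he
  have hS : Finset.univ.map e.toEmbedding = S := Finset.map_orderEmbOfFin_univ S rfl
  rw [onFinset_eq _ v rfl, ← he, quadraticPart_apply 𝓒 q₂ f hf (d := d ∘ e)
    (v := v ∘ e) (fun i => hv _ (Finset.orderEmbOfFin_mem _ _ _))]
  congr 1
  conv_rhs => rw [← hS]
  rw [sum_powerset_map, Finset.powerset_univ]
  refine Finset.sum_congr rfl fun P _ => ?_
  rw [← Finset.map_sdiff, ← Finset.compl_eq_univ_sdiff,
    crossSign_map d e.toEmbedding e.strictMono, onFinset_map f v e.toEmbedding e.strictMono,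
    onFinset_map f v e.toEmbedding e.strictMono]
  rfl

end Quadratic

/-! ### Homotopy transfer -/

theorem map_intUnits_smul {K V W : Type*} [Field K] [AddCommGroup V] [Module K V] [AddCommGroup W]
    [Module K W] (f : V →ₗ[K] W) (u : ℤˣ) (x : V) : f (u • x) = u • f x := by
  rw [Units.smul_def, map_zsmul, Units.smul_def]

theorem intUnits_smul_mem {K V : Type*} [Field K] [AddCommGroup V] [Module K V] {p : Submodule K V}
    (u : ℤˣ) {x : V} (hx : x ∈ p) : u • x ∈ p := by
  rw [Units.smul_def]
  exact zsmul_mem hx _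

/-- The suspension `W = H[1]` of a differential graded Lie algebra `H`, as the space with the
operations `q₁` and `q₂` of an `L_∞` structure, together with a contraction of its underlying
complex onto `(C, δ₁)`. -/
structure IsTransferDatum {K C W : Type*} [Field K] [AddCommGroup C] [Module K C]
    [AddCommGroup W] [Module K W] (𝓒 : ℤ → Submodule K C) (𝓦 : ℤ → Submodule K W)
    (q₁ : W →ₗ[K] W) (q₂ : W →ₗ[K] W →ₗ[K] W) (ι : C →ₗ[K] W) (H : W →ₗ[K] W) (π : W →ₗ[K] C)
    (δ₁ : C →ₗ[K] C) : Prop where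
  q₁_mem : ∀ {i : ℤ} {x : W}, x ∈ 𝓦 i → q₁ x ∈ 𝓦 (i + 1)
  q₂_mem : ∀ {i j : ℤ} {x y : W}, x ∈ 𝓦 i → y ∈ 𝓦 j → q₂ x y ∈ 𝓦 (i + j + 1)
  ι_mem : ∀ {i : ℤ} {x : C}, x ∈ 𝓒 i → ι x ∈ 𝓦 i
  H_mem : ∀ {i : ℤ} {x : W}, x ∈ 𝓦 (i + 1) → H x ∈ 𝓦 i
  π_mem : ∀ {i : ℤ} {x : W}, x ∈ 𝓦 i → π x ∈ 𝓒 i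
  δ₁_mem : ∀ {i : ℤ} {x : C}, x ∈ 𝓒 i → δ₁ x ∈ 𝓒 (i + 1)
  symm : ∀ {i j : ℤ} {x y : W}, x ∈ 𝓦 i → y ∈ 𝓦 j → q₂ x y = (i * j).negOnePow • q₂ y x
  leibniz : ∀ {i j : ℤ} {x y : W}, x ∈ 𝓦 i → y ∈ 𝓦 j →
    q₁ (q₂ x y) = -(q₂ (q₁ x) y + i.negOnePow • q₂ x (q₁ y))
  jacobi : ∀ {i j k : ℤ} {x y z : W}, x ∈ 𝓦 i → y ∈ 𝓦 j → z ∈ 𝓦 k →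
    q₂ (q₂ x y) z + (i * (j + k)).negOnePow • q₂ (q₂ y z) x +
      (k * (i + j)).negOnePow • q₂ (q₂ z x) y = 0
  δ₁_δ₁ : ∀ x, δ₁ (δ₁ x) = 0
  q₁_ι : ∀ x, q₁ (ι x) = ι (δ₁ x)
  π_q₁ : ∀ x, π (q₁ x) = δ₁ (π x)
  homotopy : ∀ x, q₁ (H x) + H (q₁ x) = ι (π x) - x

section LinearPart

variable (K : Type*) (C : Type*) [Field K] [AddCommGroup C] [Module K C]

/-- The family of multilinear maps which is the identity for `n = 1` and vanishes otherwise. -/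
def linearPart : ∀ n : ℕ, MultilinearMap K (fun _ : Fin n => C) C
  | 1 => MultilinearMap.ofSubsingleton K C C 0 LinearMap.id
  | _ => 0

variable {K C}

theorem linearPart_eq_zero {n : ℕ} (h : n ≠ 1) : linearPart K C n = 0 := by
  rcases n with _ | _ | n
  · rfl
  · exact absurd rfl h
  · rfl

variable {I : Type*} [LinearOrder I]

theorem onFinset_linearPart_singleton (v : I → C) (i : I) :
    onFinset (linearPart K C) v {i} = v i := by
  rw [onFinset_singleton]
  rfl

theorem onFinset_linearPart_eq_zero (v : I → C) {S : Finset I} (h : S.card ≠ 1) :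
    onFinset (linearPart K C) v S = 0 := by
  rw [onFinset_eq _ _ rfl, linearPart_eq_zero h]
  rfl

theorem onFinset_linearPart_mem (𝓒 : ℤ → Submodule K C) {d : I → ℤ} {v : I → C} {S : Finset I}
    (hv : ∀ i ∈ S, v i ∈ 𝓒 (d i)) : onFinset (linearPart K C) v S ∈ 𝓒 (∑ i ∈ S, d i) := by
  by_cases h : S.card = 1
  · obtain ⟨i, rfl⟩ := Finset.card_eq_one.1 h
    rw [onFinset_linearPart_singleton, Finset.sum_singleton]
    exact hv i (Finset.mem_singleton_self i)
  · rw [onFinset_linearPart_eq_zero v h]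
    exact zero_mem _

end LinearPart

section Transfer

variable {K C W : Type*} [Field K] [AddCommGroup C] [Module K C] [AddCommGroup W]
  [Module K W] (𝓒 : ℤ → Submodule K C) [DirectSum.Decomposition 𝓒] (q₂ : W →ₗ[K] W →ₗ[K] W)
  (ι : C →ₗ[K] W) (H : W →ₗ[K] W) (π : W →ₗ[K] C) (δ₁ : C →ₗ[K] C)

/-- The components of `q₂ ∘ ι_∞`. -/
abbrev transferQuadratic (n : ℕ) : MultilinearMap K (fun _ : Fin n => C) W :=
  quadraticPart 𝓒 q₂ n (fun k _ => transferMap 𝓒 q₂ ι H k)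

theorem transferMap_zero : transferMap 𝓒 q₂ ι H 0 = 0 := by
  simp [transferMap]

theorem quadraticPart_zero (f : ∀ k, k < 0 → MultilinearMap K (fun _ : Fin k => C) W) :
    quadraticPart 𝓒 q₂ 0 f = 0 := by
  -- Truncated subtraction gives `0 - 1 = 0`, so the sum has no terms in arity zero either.
  have : IsEmpty (Fin (0 - 1)) := Fin.isEmpty
  rw [quadraticPart, Fintype.sum_empty, smul_zero]

theorem quadraticPart_one (f : ∀ k, k < 1 → MultilinearMap K (fun _ : Fin k => C) W) :
    quadraticPart 𝓒 q₂ 1 f = 0 := by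
  have : IsEmpty (Fin (1 - 1)) := Fin.isEmpty
  rw [quadraticPart, Fintype.sum_empty, smul_zero]

/-- The quadratic part vanishes in arities zero and one and the linear part in all arities but one,
so one formula replaces the case distinction of the recursion. -/
theorem transferMap_apply (n : ℕ) (v : Fin n → C) : transferMap 𝓒 q₂ ι H n v =
    ι (linearPart K C n v) + H (transferQuadratic 𝓒 q₂ ι H n v) := by
  rcases n with _ | _ | n
  · simp [transferMap, linearPart, quadraticPart_zero]
  · simp [transferMap, linearPart, quadraticPart_one]
  · simp [transferMap, linearPart]

theorem transferBracket_apply (n : ℕ) (v : Fin n → C) : transferBracket 𝓒 q₂ ι H π δ₁ n v =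
    δ₁ (linearPart K C n v) + π (transferQuadratic 𝓒 q₂ ι H n v) := by
  rcases n with _ | _ | n
  · simp [transferBracket, linearPart, quadraticPart_zero]
  · simp [transferBracket, linearPart, quadraticPart_one]
  · simp [transferBracket, linearPart]

variable {I : Type*} [LinearOrder I]

theorem onFinset_transferMap (v : I → C) (S : Finset I) :
    onFinset (transferMap 𝓒 q₂ ι H) v S = ι (onFinset (linearPart K C) v S) +
      H (onFinset (transferQuadratic 𝓒 q₂ ι H) v S) :=
  transferMap_apply ..

theorem onFinset_transferBracket (v : I → C) (S : Finset I) :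
    onFinset (transferBracket 𝓒 q₂ ι H π δ₁) v S = δ₁ (onFinset (linearPart K C) v S) +
      π (onFinset (transferQuadratic 𝓒 q₂ ι H) v S) :=
  transferBracket_apply ..

variable {𝓒} {q₂ ι H π δ₁} {𝓦 : ℤ → Submodule K W} {q₁ : W →ₗ[K] W}
  (D : IsTransferDatum 𝓒 𝓦 q₁ q₂ ι H π δ₁)
include D

variable {d : I → ℤ} {v : I → C}

theorem transferMap_mem (S : Finset I) (hv : ∀ i ∈ S, v i ∈ 𝓒 (d i)) :
    onFinset (transferQuadratic 𝓒 q₂ ι H) v S ∈ 𝓦 (∑ i ∈ S, d i + 1) ∧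
      onFinset (transferMap 𝓒 q₂ ι H) v S ∈ 𝓦 (∑ i ∈ S, d i) := by
  induction S using Finset.strongInduction with
  | H S ih =>
    have hQ : onFinset (transferQuadratic 𝓒 q₂ ι H) v S ∈ 𝓦 (∑ i ∈ S, d i + 1) := by
      rw [onFinset_quadraticPart 𝓒 q₂ _ (transferMap_zero ..) hv]
      refine Submodule.smul_mem _ _ (sum_mem fun P hP => intUnits_smul_mem _ ?_)
      rw [Finset.mem_powerset] at hP
      -- The two improper partitions contribute zero; for all others both `P` and `S \ P` are proper
      -- subsets, to which the induction applies.
      rcases eq_or_ne P ∅ with h0 | h0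
      · rw [h0, onFinset_empty _ (transferMap_zero ..)]
        simp
      rcases eq_or_ne P S with h1 | h1
      · rw [h1, Finset.sdiff_self, onFinset_empty _ (transferMap_zero ..)]
        simp
      rw [← Finset.sum_sdiff hP, add_comm (∑ i ∈ S \ P, d i)]
      have hR : S \ P ⊂ S := Finset.sdiff_ssubset hP (Finset.nonempty_iff_ne_empty.2 h0)
      exact D.q₂_mem (ih P (hP.ssubset_of_ne h1) fun i hi => hv i (hP hi)).2
        (ih _ hR fun i hi => hv i (hR.1 hi)).2
    refine ⟨hQ, ?_⟩
    rw [onFinset_transferMap]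
    exact add_mem (D.ι_mem (onFinset_linearPart_mem 𝓒 hv)) (D.H_mem hQ)

theorem transferBracket_mem (S : Finset I) (hv : ∀ i ∈ S, v i ∈ 𝓒 (d i)) :
    onFinset (transferBracket 𝓒 q₂ ι H π δ₁) v S ∈ 𝓒 (∑ i ∈ S, d i + 1) := by
  rw [onFinset_transferBracket]
  exact add_mem (D.δ₁_mem (onFinset_linearPart_mem 𝓒 hv)) (D.π_mem (transferMap_mem D S hv).1)

omit D in
theorem onFinset_linearPart_comp {J : Type*} [LinearOrder J] (w : J ↪ I) (d : I → ℤ) (v : I → C)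
    (S : Finset J) : onFinset (linearPart K C) (v ∘ w) S =
      inversionSign w d S • onFinset (linearPart K C) v (S.map w) := by
  by_cases h : S.card = 1
  · obtain ⟨i, rfl⟩ := Finset.card_eq_one.1 h
    rw [Finset.map_singleton, onFinset_linearPart_singleton, onFinset_linearPart_singleton]
    simp [inversionSign]
  · rw [onFinset_linearPart_eq_zero _ h, onFinset_linearPart_eq_zero _ (by rwa [Finset.card_map]),
      smul_zero]

omit D in
-- This is graded symmetry, stated for subsets and injections so that it can be proved by induction:
-- reordering `S` reorders both parts of each partition, and `inversionSign_union_mul` matches the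
-- signs.
theorem transferQuadratic_comp {J : Type*} [LinearOrder J] (w : J ↪ I) (S : Finset J)
    (hv : ∀ i, v i ∈ 𝓒 (d i)) : onFinset (transferQuadratic 𝓒 q₂ ι H) (v ∘ w) S =
      inversionSign w d S • onFinset (transferQuadratic 𝓒 q₂ ι H) v (S.map w) ∧
    onFinset (transferMap 𝓒 q₂ ι H) (v ∘ w) S =
      inversionSign w d S • onFinset (transferMap 𝓒 q₂ ι H) v (S.map w) := by
  induction S using Finset.strongInduction with
  | H S ih =>
    have hQ : onFinset (transferQuadratic 𝓒 q₂ ι H) (v ∘ w) S =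
        inversionSign w d S • onFinset (transferQuadratic 𝓒 q₂ ι H) v (S.map w) := by
      rw [onFinset_quadraticPart 𝓒 q₂ _ (transferMap_zero ..) (d := d ∘ w) (v := v ∘ w)
          fun i _ => hv (w i),
        onFinset_quadraticPart 𝓒 q₂ _ (transferMap_zero ..) fun i _ => hv i,
        smul_comm (inversionSign w d S), Finset.smul_sum (r := inversionSign w d S)]
      congr 1
      rw [sum_powerset_map]
      refine Finset.sum_congr rfl fun P hP => ?_
      rw [Finset.mem_powerset] at hP
      rw [← Finset.map_sdiff]
      rcases eq_or_ne P ∅ with h0 | h0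
      · rw [h0, onFinset_empty _ (transferMap_zero ..), Finset.map_empty,
          onFinset_empty _ (transferMap_zero ..)]
        simp
      rcases eq_or_ne P S with h1 | h1
      · rw [h1, Finset.sdiff_self, onFinset_empty _ (transferMap_zero ..), Finset.map_empty,
          onFinset_empty _ (transferMap_zero ..)]
        simp
      have hR : S \ P ⊂ S := Finset.sdiff_ssubset hP (Finset.nonempty_iff_ne_empty.2 h0)
      rw [(ih P (hP.ssubset_of_ne h1)).2, (ih _ hR).2, map_intUnits_smul, map_intUnits_smul,
        LinearMap.smul_apply, smul_smul, smul_smul, smul_smul]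
      congr 1
      have key := inversionSign_union_mul w d (Finset.disjoint_sdiff (s := P) (t := S))
      rw [Finset.union_sdiff_of_subset hP] at key
      have hc := Int.units_mul_self (crossSign (d ∘ w) P (S \ P))
      have he := Int.units_mul_self (crossSign d (P.map w) ((S \ P).map w))
      calc _ = inversionSign w d P * inversionSign w d (S \ P) *
            crossSign d (P.map w) ((S \ P).map w) * crossSign d (P.map w) ((S \ P).map w) *
            crossSign (d ∘ w) P (S \ P) := by
            rw [mul_assoc (inversionSign w d P * _), he, mul_one, mul_comm, mul_comm
              (crossSign (d ∘ w) P (S \ P)), ← mul_assoc]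
        _ = _ := by
            rw [← key, mul_right_comm, mul_assoc (inversionSign w d S), hc, mul_one]
    refine ⟨hQ, ?_⟩
    rw [onFinset_transferMap, onFinset_transferMap, hQ, onFinset_linearPart_comp w d,
      map_intUnits_smul, map_intUnits_smul, smul_add]

omit D in
theorem transferBracket_comp {J : Type*} [LinearOrder J] (w : J ↪ I) (S : Finset J)
    (hv : ∀ i, v i ∈ 𝓒 (d i)) : onFinset (transferBracket 𝓒 q₂ ι H π δ₁) (v ∘ w) S =
      inversionSign w d S • onFinset (transferBracket 𝓒 q₂ ι H π δ₁) v (S.map w) := by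
  rw [onFinset_transferBracket, onFinset_transferBracket, (transferQuadratic_comp w S hv).1,
    onFinset_linearPart_comp w d, map_intUnits_smul, map_intUnits_smul, smul_add]

variable [CharZero K]

/-- By symmetry of `q₂` a partition and its reverse contribute equally. Keeping the one whose first
part contains `a` cancels the factor `½`. -/
theorem transferQuadratic_insert (S : Finset I) {a : I} (ha : ∀ j ∈ S, a < j)
    (hv : ∀ i ∈ insert a S, v i ∈ 𝓒 (d i)) :
    onFinset (transferQuadratic 𝓒 q₂ ι H) v (insert a S) = ∑ U ∈ S.powerset,
      crossSign d U (S \ U) • q₂ (onList (transferMap 𝓒 q₂ ι H) (v a :: U.sort.map v))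
        (onFinset (transferMap 𝓒 q₂ ι H) v (S \ U)) := by
  have haS : a ∉ S := fun h => lt_irrefl _ (ha a h)
  have hs : ∀ U ∈ S.powerset, crossSign d (insert a U) (insert a S \ insert a U) •
        q₂ (onFinset (transferMap 𝓒 q₂ ι H) v (insert a U))
          (onFinset (transferMap 𝓒 q₂ ι H) v (insert a S \ insert a U)) =
      crossSign d U (S \ U) • q₂ (onList (transferMap 𝓒 q₂ ι H) (v a :: U.sort.map v))
        (onFinset (transferMap 𝓒 q₂ ι H) v (S \ U)) := by
    intro U hU
    rw [Finset.mem_powerset] at hU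
    rw [Finset.insert_sdiff_insert, Finset.sdiff_insert_of_notMem haS,
      crossSign_insert_bot d (fun j hj => ha j (Finset.sdiff_subset hj)) fun h => haS (hU h),
      onFinset_insert_bot _ _ fun j hj => ha j (hU hj)]
  rw [onFinset_quadraticPart 𝓒 q₂ _ (transferMap_zero ..) hv, Finset.sum_powerset_insert haS,
    ← Finset.sum_congr rfl hs]
  have e : ∑ P ∈ S.powerset, crossSign d P (insert a S \ P) •
        q₂ (onFinset (transferMap 𝓒 q₂ ι H) v P)
          (onFinset (transferMap 𝓒 q₂ ι H) v (insert a S \ P)) =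
      ∑ U ∈ S.powerset, crossSign d (insert a U) (insert a S \ insert a U) •
        q₂ (onFinset (transferMap 𝓒 q₂ ι H) v (insert a U))
          (onFinset (transferMap 𝓒 q₂ ι H) v (insert a S \ insert a U)) := by
    have e1 : ∀ P ∈ S.powerset, crossSign d P (insert a S \ P) •
        q₂ (onFinset (transferMap 𝓒 q₂ ι H) v P)
          (onFinset (transferMap 𝓒 q₂ ι H) v (insert a S \ P)) =
        crossSign d P (insert a (S \ P)) • q₂ (onFinset (transferMap 𝓒 q₂ ι H) v P)
          (onFinset (transferMap 𝓒 q₂ ι H) v (insert a (S \ P))) := by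
      intro P hP
      rw [Finset.insert_sdiff_of_notMem _ fun h => haS (Finset.mem_powerset.1 hP h)]
    rw [Finset.sum_congr rfl e1, sum_powerset_compl S fun P R => crossSign d P (insert a R) •
      q₂ (onFinset (transferMap 𝓒 q₂ ι H) v P) (onFinset (transferMap 𝓒 q₂ ι H) v (insert a R))]
    refine Finset.sum_congr rfl fun U hU => ?_
    rw [Finset.mem_powerset] at hU
    rw [Finset.insert_sdiff_insert, Finset.sdiff_insert_of_notMem haS]
    have hd : Disjoint (S \ U) (insert a U) := by
      rw [Finset.disjoint_insert_right]
      exact ⟨fun h => haS (Finset.sdiff_subset h), Finset.sdiff_disjoint⟩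
    rw [crossSign_comm d hd, D.symm
      (transferMap_mem D (S \ U) fun i hi => hv i (Finset.mem_insert_of_mem
        (Finset.sdiff_subset hi))).2
      (transferMap_mem D (insert a U) fun i hi => hv i (Finset.insert_subset_insert a hU hi)).2,
      smul_smul, mul_right_comm, Int.units_mul_self, one_mul]
  rw [e, ← two_smul K, smul_smul, inv_mul_cancel₀ two_ne_zero, one_smul]

theorem transferQuadratic_cons (S : Finset I) (hv : ∀ i ∈ S, v i ∈ 𝓒 (d i)) {k : ℤ} {x : C}
    (hx : x ∈ 𝓒 k) :
    onList (transferQuadratic 𝓒 q₂ ι H) (x :: S.sort.map v) = ∑ U ∈ S.powerset,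
      crossSign d U (S \ U) • q₂ (onList (transferMap 𝓒 q₂ ι H) (x :: U.sort.map v))
        (onFinset (transferMap 𝓒 q₂ ι H) v (S \ U)) := by
  -- The vector `x`, in the application the value of a bracket, has no index in `I`; it receives the
  -- new least index `⊥`.
  let e : I ↪ WithBot I := ⟨WithBot.some, WithBot.coe_injective⟩
  have he : StrictMono e := WithBot.coe_strictMono
  let v' : WithBot I → C := WithBot.recBotCoe x v
  let d' : WithBot I → ℤ := WithBot.recBotCoe k d
  have hl : ∀ U : Finset I, x :: U.sort.map v = v' ⊥ :: (U.map e).sort.map v' := by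
    intro U
    rw [← (he.strictMonoOn _).map_finsetSort, List.map_map]
    rfl
  have hb : ∀ U : Finset I, ∀ j ∈ U.map e, ⊥ < j := by
    intro U j hj
    obtain ⟨i, _, rfl⟩ := Finset.mem_map.1 hj
    exact WithBot.bot_lt_coe i
  rw [hl, ← onFinset_insert_bot _ v' (hb S), transferQuadratic_insert D (d := d') _ (hb S)]
  · rw [sum_powerset_map]
    refine Finset.sum_congr rfl fun P _ => ?_
    rw [← Finset.map_sdiff, crossSign_map _ e he, onFinset_map _ v' e he, hl]
    rfl
  · intro i hi
    rcases Finset.mem_insert.1 hi with rfl | hi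
    · exact hx
    · obtain ⟨j, hj, rfl⟩ := Finset.mem_map.1 hi
      exact hv j hj

end Transfer

/-! ### The square of the transferred coderivation -/

section SquareZero

variable {K C W : Type*} [Field K] [AddCommGroup C] [Module K C] [AddCommGroup W] [Module K W]
  {I : Type*} [LinearOrder I]

/-- The product `q₂ (X ⊙ Y)` of families indexed by finite sets. -/
def starProduct (d : I → ℤ) (q₂ : W →ₗ[K] W →ₗ[K] W) (X Y : Finset I → W) (S : Finset I) : W :=
  ∑ P ∈ S.powerset, crossSign d P (S \ P) • q₂ (X P) (Y (S \ P))

theorem starProduct_add_left (d : I → ℤ) (q₂ : W →ₗ[K] W →ₗ[K] W) (X X' Y : Finset I → W)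
    (S : Finset I) : starProduct d q₂ (fun T => X T + X' T) Y S =
      starProduct d q₂ X Y S + starProduct d q₂ X' Y S := by
  simp [starProduct, smul_add, Finset.sum_add_distrib]

theorem starProduct_smul_left (d : I → ℤ) (q₂ : W →ₗ[K] W →ₗ[K] W) (c : K) (X Y : Finset I → W)
    (S : Finset I) : starProduct d q₂ (fun T => c • X T) Y S = c • starProduct d q₂ X Y S := by
  simp [starProduct, Finset.smul_sum, smul_comm c]

/-- The term of `P = S` vanishes with `Y ∅`, so knowledge of proper subsets suffices; this closes
the induction in `sum_transferMap_cons`. -/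
theorem starProduct_congr_left (d : I → ℤ) (q₂ : W →ₗ[K] W →ₗ[K] W) {X X' Y : Finset I → W}
    {S : Finset I} (hY : Y ∅ = 0) (h : ∀ T, T ⊂ S → X T = X' T) :
    starProduct d q₂ X Y S = starProduct d q₂ X' Y S := by
  refine Finset.sum_congr rfl fun P hP => ?_
  rcases eq_or_ne P S with rfl | h1
  · simp [hY]
  · rw [h P ((Finset.mem_powerset.1 hP).ssubset_of_ne h1)]

variable {𝓒 : ℤ → Submodule K C} [DirectSum.Decomposition 𝓒] {𝓦 : ℤ → Submodule K W}
  {q₁ : W →ₗ[K] W} {q₂ : W →ₗ[K] W →ₗ[K] W} {ι : C →ₗ[K] W} {H : W →ₗ[K] W} {π : W →ₗ[K] C}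
  {δ₁ : C →ₗ[K] C} (D : IsTransferDatum 𝓒 𝓦 q₁ q₂ ι H π δ₁) {d : I → ℤ}

include D

omit [DirectSum.Decomposition 𝓒] in
-- The Leibniz rule gives two terms for each partition; symmetry of `q₂` turns the second into the
-- first for the reversed partition, whence the factor two.
theorem starProduct_leibniz {F : Finset I → W} (hF : ∀ S, F S ∈ 𝓦 (∑ i ∈ S, d i))
    (S : Finset I) : q₁ (starProduct d q₂ F F S) =
      -((2 : K) • starProduct d q₂ (fun T => q₁ (F T)) F S) := by
  have e : ∀ P ∈ S.powerset, q₁ (crossSign d P (S \ P) • q₂ (F P) (F (S \ P))) =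
      -(crossSign d P (S \ P) • q₂ (q₁ (F P)) (F (S \ P)) +
        crossSign d (S \ P) P • q₂ (q₁ (F (S \ P))) (F P)) := by
    intro P _
    rw [map_intUnits_smul, D.leibniz (hF _) (hF _), D.symm (hF P) (D.q₁_mem (hF (S \ P))), smul_neg,
      smul_add, crossSign_comm d (Finset.disjoint_sdiff (s := P) (t := S)), smul_smul, smul_smul,
      mul_add, Int.negOnePow_add, mul_one]
    congr 3
    generalize crossSign d (S \ P) P = a
    generalize ((∑ i ∈ P, d i) * ∑ i ∈ S \ P, d i).negOnePow = b
    generalize (∑ i ∈ P, d i).negOnePow = c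
    have hb := Int.units_mul_self b
    have hc := Int.units_mul_self c
    calc b * a * c * (b * c) = a * (b * b) * (c * c) := by
          simp only [mul_comm, mul_left_comm]
      _ = a := by rw [hb, hc, mul_one, mul_one]
  rw [starProduct, map_sum, Finset.sum_congr rfl e, Finset.sum_neg_distrib, Finset.sum_add_distrib,
    two_smul]
  congr 2
  exact (sum_powerset_compl S fun P R => crossSign d P R • q₂ (q₁ (F P)) (F R)).symm

variable [CharZero K]

omit [DirectSum.Decomposition 𝓒] in
-- The left side is a sum over ordered partitions into three parts, unchanged when the parts are
-- rotated. The three rotated sums add up to zero term by term by the Jacobi identity, and `3` is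
-- invertible.
theorem starProduct_jacobi {F : Finset I → W} (hF : ∀ S, F S ∈ 𝓦 (∑ i ∈ S, d i))
    (S : Finset I) : starProduct d q₂ (starProduct d q₂ F F) F S = 0 := by
  let g : Finset I → Finset I → Finset I → W := fun P U Z =>
    (crossSign d P U * crossSign d P Z * crossSign d U Z) • q₂ (q₂ (F P) (F U)) (F Z)
  have e : starProduct d q₂ (starProduct d q₂ F F) F S =
      ∑ X ∈ S.powerset, ∑ P ∈ X.powerset, g P (X \ P) (S \ X) := by
    refine Finset.sum_congr rfl fun X hX => ?_
    rw [starProduct, map_sum, LinearMap.sum_apply, Finset.smul_sum]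
    refine Finset.sum_congr rfl fun P hP => ?_
    rw [Finset.mem_powerset] at hP
    rw [map_intUnits_smul, LinearMap.smul_apply, smul_smul]
    congr 1
    nth_rw 1 [← Finset.union_sdiff_of_subset hP]
    rw [crossSign_union_left d Finset.disjoint_sdiff, mul_comm, ← mul_assoc]
  have hg : ∀ X ∈ S.powerset, ∀ P ∈ X.powerset, g P (X \ P) (S \ X) + g (X \ P) (S \ X) P +
      g (S \ X) P (X \ P) = 0 := by
    intro X hX P hP
    rw [Finset.mem_powerset] at hX hP
    have h1 : Disjoint P (X \ P) := Finset.disjoint_sdiff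
    have h2 : Disjoint P (S \ X) := Finset.disjoint_of_subset_left hP Finset.disjoint_sdiff
    have h3 : Disjoint (X \ P) (S \ X) :=
      Finset.disjoint_of_subset_left Finset.sdiff_subset Finset.disjoint_sdiff
    generalize X \ P = U at *
    generalize S \ X = Z at *
    have key := congrArg ((crossSign d P U * crossSign d P Z * crossSign d U Z) • ·)
      (D.jacobi (hF P) (hF U) (hF Z))
    simp only [smul_add, smul_smul, smul_zero] at key
    rw [← key]
    simp only [g]
    rw [crossSign_comm d h1.symm, crossSign_comm d h2.symm, crossSign_comm d h3.symm]
    simp only [mul_add, Int.negOnePow_add, mul_comm, mul_left_comm, mul_assoc]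
  have r1 := sum_powerset_powerset_rotate S g
  have r2 := sum_powerset_powerset_rotate S fun P U Z => g U Z P
  have h3 : (3 : K) • starProduct d q₂ (starProduct d q₂ F F) F S = 0 := by
    have : (3 : K) = 1 + 1 + 1 := by norm_num
    rw [this, add_smul, add_smul, one_smul]
    refine (congrArg₂ (· + ·) (congrArg₂ (· + ·) e (e.trans r1)) (e.trans (r1.trans r2))).trans ?_
    rw [← Finset.sum_add_distrib, ← Finset.sum_add_distrib]
    refine Finset.sum_eq_zero fun X hX => ?_
    rw [← Finset.sum_add_distrib, ← Finset.sum_add_distrib]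
    exact Finset.sum_eq_zero fun P hP => hg X hX P hP
  exact (smul_eq_zero.1 h3).resolve_left three_ne_zero

variable {v : I → C} (hv : ∀ i, v i ∈ 𝓒 (d i))
include hv

/-- Jacobi removes the contribution of `Q = ½ F * F`, and Leibniz identifies `(q₁ F) * F` with `-½
q₁ (F * F)`. -/
theorem starProduct_curvature (S : Finset I) :
    starProduct d q₂ (fun T => q₁ (onFinset (transferMap 𝓒 q₂ ι H) v T) +
      onFinset (transferQuadratic 𝓒 q₂ ι H) v T) (onFinset (transferMap 𝓒 q₂ ι H) v) S =
    -q₁ (onFinset (transferQuadratic 𝓒 q₂ ι H) v S) := by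
  have hF : ∀ S, onFinset (transferMap 𝓒 q₂ ι H) v S ∈ 𝓦 (∑ i ∈ S, d i) :=
    fun S => (transferMap_mem D S fun i _ => hv i).2
  have hQ : onFinset (transferQuadratic 𝓒 q₂ ι H) v = fun S => (2⁻¹ : K) •
      starProduct d q₂ (onFinset (transferMap 𝓒 q₂ ι H) v)
        (onFinset (transferMap 𝓒 q₂ ι H) v) S := by
    funext S
    exact onFinset_quadraticPart 𝓒 q₂ _ (transferMap_zero ..) fun i _ => hv i
  rw [starProduct_add_left, hQ, starProduct_smul_left, starProduct_jacobi D hF, map_smul,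
    starProduct_leibniz D hF, smul_zero, add_zero, smul_neg, neg_neg, smul_smul,
    inv_mul_cancel₀ two_ne_zero, one_smul]

/-- The composite of the extension of the brackets to a coderivation with a map whose linear and
quadratic parts are `φ` and `ψ`. -/
theorem sum_cons_eq {V : Type*} [AddCommGroup V] [Module K V] (φ : C →ₗ[K] V) (ψ : W →ₗ[K] V)
    {b : Finset I → C} (hb : ∀ P, b P ∈ 𝓒 (∑ i ∈ P, d i + 1)) (S : Finset I) :
    ∑ P ∈ S.powerset, crossSign d P (S \ P) •
        (φ (onList (linearPart K C) (b P :: (S \ P).sort.map v)) +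
          ψ (onList (transferQuadratic 𝓒 q₂ ι H) (b P :: (S \ P).sort.map v))) =
      φ (b S) + ψ (starProduct d q₂ (fun T => ∑ P ∈ T.powerset, crossSign d P (T \ P) •
        onList (transferMap 𝓒 q₂ ι H) (b P :: (T \ P).sort.map v))
          (onFinset (transferMap 𝓒 q₂ ι H) v) S) := by
  simp only [smul_add, Finset.sum_add_distrib]
  congr 1
  -- The linear part sees only lists of length one, which forces `P = S`.
  · rw [Finset.sum_eq_single S]
    · rw [Finset.sdiff_self, Finset.sort_empty, crossSign_empty_right, one_smul]
      rfl
    · intro P hP hPS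
      have : ((S \ P).sort.map v).length ≠ 0 := by
        rw [List.length_map, Finset.length_sort, Finset.card_ne_zero, Finset.sdiff_nonempty]
        exact fun h => hPS ((Finset.mem_powerset.1 hP).antisymm h)
      rw [onList, linearPart_eq_zero (by rw [List.length_cons]; omega)]
      simp
    · intro h
      exact absurd (Finset.mem_powerset_self S) h
  -- Expanding the quadratic part partitions `S` into `P`, the set `U` sharing a factor with `b P`,
  -- and the rest. Summing over `X = P ∪ U` first gives the star product.
  · have e : ∀ P ∈ S.powerset, crossSign d P (S \ P) •
        ψ (onList (transferQuadratic 𝓒 q₂ ι H) (b P :: (S \ P).sort.map v)) =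
        ∑ U ∈ (S \ P).powerset, ψ ((crossSign d P U * crossSign d P ((S \ P) \ U) *
          crossSign d U ((S \ P) \ U)) •
          q₂ (onList (transferMap 𝓒 q₂ ι H) (b P :: U.sort.map v))
            (onFinset (transferMap 𝓒 q₂ ι H) v ((S \ P) \ U))) := by
      intro P _
      rw [transferQuadratic_cons D (S \ P) (fun i _ => hv i) (hb P), map_sum, Finset.smul_sum]
      refine Finset.sum_congr rfl fun U hU => ?_
      nth_rw 1 [← Finset.union_sdiff_of_subset (Finset.mem_powerset.1 hU)]
      rw [crossSign_union_right d P Finset.disjoint_sdiff, ← map_intUnits_smul, smul_smul]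
    let g : Finset I → Finset I → Finset I → V := fun P U Z =>
      ψ ((crossSign d P U * crossSign d P Z * crossSign d U Z) •
          q₂ (onList (transferMap 𝓒 q₂ ι H) (b P :: U.sort.map v))
            (onFinset (transferMap 𝓒 q₂ ι H) v Z))
    refine (Finset.sum_congr rfl e).trans ((sum_powerset_powerset S g).trans ?_)
    rw [starProduct, map_sum]
    refine Finset.sum_congr rfl fun X hX => ?_
    rw [map_sum, LinearMap.sum_apply, Finset.smul_sum, map_sum]
    refine Finset.sum_congr rfl fun P hP => ?_
    have hs : crossSign d X (S \ X) = crossSign d P (S \ X) * crossSign d (X \ P) (S \ X) := by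
      rw [← crossSign_union_left d Finset.disjoint_sdiff,
        Finset.union_sdiff_of_subset (Finset.mem_powerset.1 hP)]
    simp only [g]
    rw [map_intUnits_smul q₂, LinearMap.smul_apply, smul_smul, hs]
    congr 2
    simp only [mul_comm, mul_left_comm]

/-- This says that `ι_∞` is a morphism of `L_∞`-algebras from the transferred brackets to `(q₁,
q₂)`. -/
theorem sum_transferMap_cons (S : Finset I) :
    ∑ P ∈ S.powerset, crossSign d P (S \ P) • onList (transferMap 𝓒 q₂ ι H)
        (onFinset (transferBracket 𝓒 q₂ ι H π δ₁) v P :: (S \ P).sort.map v) =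
      q₁ (onFinset (transferMap 𝓒 q₂ ι H) v S) +
        onFinset (transferQuadratic 𝓒 q₂ ι H) v S := by
  induction S using Finset.strongInduction with
  | H S ih =>
    have h := sum_cons_eq D hv ι H (fun P => transferBracket_mem D P fun i _ => hv i) S
    rw [starProduct_congr_left d q₂ (onFinset_empty _ (transferMap_zero ..) _) ih,
      starProduct_curvature D hv] at h
    refine (Finset.sum_congr rfl fun P _ => ?_).trans (h.trans ?_)
    · congr 1
      exact transferMap_apply ..
    -- It remains to turn `ι π Q - H q₁ Q` into `q₁ H Q + Q`.
    · have hh := D.homotopy (onFinset (transferQuadratic 𝓒 q₂ ι H) v S)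
      rw [onFinset_transferBracket, onFinset_transferMap, map_add, map_add, D.q₁_ι, map_neg,
        eq_sub_of_add_eq hh]
      abel

theorem sum_transferBracket_cons (S : Finset I) :
    ∑ P ∈ S.powerset, crossSign d P (S \ P) • onList (transferBracket 𝓒 q₂ ι H π δ₁)
        (onFinset (transferBracket 𝓒 q₂ ι H π δ₁) v P :: (S \ P).sort.map v) = 0 := by
  have h := sum_cons_eq D hv δ₁ π (fun P => transferBracket_mem D P fun i _ => hv i) S
  simp only [sum_transferMap_cons D hv, starProduct_curvature D hv] at h
  refine (Finset.sum_congr rfl fun P _ => ?_).trans (h.trans ?_)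
  · congr 1
    exact transferBracket_apply ..
  · rw [onFinset_transferBracket, map_add, D.δ₁_δ₁, map_neg, D.π_q₁, zero_add, add_neg_cancel]

end SquareZero

/-- Passing to subsets adds only the term of `P = ∅`, which vanishes because `q 0 = 0`. -/
theorem sum_koszulSign_nested {K V : Type*} [Field K] [AddCommGroup V] [Module K V]
    (q : ∀ n : ℕ, MultilinearMap K (fun _ : Fin n => V) V) (hq : q 0 = 0) {n : ℕ} (d : Fin n → ℤ)
    (v : Fin n → V) :
    ∑ k : Fin n, ∑ σ ∈ unshuffles (k + 1) n, koszulSign σ d •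
        q (n - (k + 1) + 1) (Fin.cons
          (q (k + 1) (fun i => v (σ ⟨i, by omega⟩)))
          (fun j : Fin (n - (k + 1)) => v (σ ⟨k + 1 + j, by omega⟩))) =
      ∑ P : Finset (Fin n), crossSign d P Pᶜ • onList q (onFinset q v P :: Pᶜ.sort.map v) := by
  have e : ∀ k : Fin n, ∑ σ ∈ unshuffles (k + 1) n, koszulSign σ d •
        q (n - (k + 1) + 1) (Fin.cons
          (q (k + 1) (fun i => v (σ ⟨i, by omega⟩)))
          (fun j : Fin (n - (k + 1)) => v (σ ⟨k + 1 + j, by omega⟩))) =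
      ∑ P ∈ Finset.univ.powersetCard (k + 1 : ℕ),
        crossSign d P Pᶜ • onList q (onFinset q v P :: Pᶜ.sort.map v) := by
    intro k
    unfold onFinset
    rw [← sum_unshuffles (by omega : (k + 1 : ℕ) ≤ n) d
      fun l l' => onList q (onList q (l.map v) :: l'.map v)]
    refine Finset.sum_congr rfl fun σ _ => ?_
    rw [List.map_ofFn, List.map_ofFn, onList_ofFn, onList_cons]
    rfl
  simp only [e]
  rw [← Finset.powerset_univ (α := Fin n), Finset.sum_powerset, Finset.card_univ, Fintype.card_fin,
    Finset.sum_range_succ', Finset.sum_eq_zero (s := Finset.powersetCard 0 _), add_zero,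
    Finset.sum_range]
  intro P hP
  rw [Finset.card_eq_zero.1 (Finset.mem_powersetCard.1 hP).2, onFinset_empty q hq,
    onList_zero_cons, smul_zero]

theorem isLInfinity_transferBracket {K C W : Type*} [Field K] [CharZero K] [AddCommGroup C]
    [Module K C] [AddCommGroup W] [Module K W] {𝓒 : ℤ → Submodule K C}
    [DirectSum.Decomposition 𝓒] {𝓦 : ℤ → Submodule K W} {q₁ : W →ₗ[K] W}
    {q₂ : W →ₗ[K] W →ₗ[K] W} {ι : C →ₗ[K] W} {H : W →ₗ[K] W} {π : W →ₗ[K] C} {δ₁ : C →ₗ[K] C}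
    (D : IsTransferDatum 𝓒 𝓦 q₁ q₂ ι H π δ₁) :
    IsLInfinity 𝓒 (transferBracket 𝓒 q₂ ι H π δ₁) where
  degree_one n _ d v hv := by
    have h := transferBracket_mem D Finset.univ fun i _ => hv i
    rwa [onFinset_univ] at h
  symmetric n _ d v hv σ := by
    have h := transferBracket_comp (q₂ := q₂) (ι := ι) (H := H) (π := π) (δ₁ := δ₁)
      σ.toEmbedding Finset.univ hv
    rwa [Finset.map_univ_equiv, onFinset_univ, onFinset_univ] at h
  sq_zero n _ d v hv := by
    rw [sum_koszulSign_nested _ (by simp [transferBracket])]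
    have h := sum_transferBracket_cons D hv Finset.univ
    simpa only [Finset.powerset_univ, ← Finset.compl_eq_univ_sdiff] using h

theorem negOnePow_eq_ite (i : ℤ) : i.negOnePow = if Even i then 1 else -1 := by
  split_ifs with h
  · exact Int.negOnePow_even i h
  · exact Int.negOnePow_odd i (Int.not_even_iff_odd.1 h)

theorem DGLA.jacobi_cyclic {K L : Type*} [Field K] [AddCommGroup L] [Module K L]
    {𝓛 : ℤ → Submodule K L} (A : DGLA 𝓛) {i j k : ℤ} {x y z : L} (hx : x ∈ 𝓛 i) (hy : y ∈ 𝓛 j)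
    (hz : z ∈ 𝓛 k) :
    A.bracket (A.bracket x y) z + (i * (j + k)).negOnePow • A.bracket (A.bracket y z) x +
      (k * (i + j)).negOnePow • A.bracket (A.bracket z x) y = 0 := by
  have h1 := A.jacobi z hx hy
  have h2 := A.skew (A.bracket_mem hy hz) hx
  have h3 := A.skew (A.bracket_mem hz hx) hy
  have h4 := A.skew hz hx
  rw [h2, h3, h4, h1]
  by_cases hi : Even i <;> by_cases hj : Even j <;> by_cases hk : Even k <;>
    simp [negOnePow_eq_ite, Int.even_mul, Int.even_add, hi, hj, hk]

/-! ### Polynomials with coefficients in a differential graded Lie algebra -/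

section Poly

variable {K M : Type*} [Field K] [AddCommGroup M] [Module K M]

/-- The grading of `M[t]`. -/
def polyGrading (𝓜 : ℤ → Submodule K M) (i : ℤ) : Submodule K (K[X] ⊗[K] M) :=
  Submodule.span K {a | ∃ (p : K[X]) (x : M), x ∈ 𝓜 i ∧ p ⊗ₜ[K] x = a}

variable {𝓜 : ℤ → Submodule K M}

theorem tmul_mem_polyGrading (p : K[X]) {i : ℤ} {x : M} (hx : x ∈ 𝓜 i) :
    p ⊗ₜ[K] x ∈ polyGrading 𝓜 i :=
  Submodule.subset_span ⟨p, x, hx, rfl⟩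

@[elab_as_elim]
theorem polyGrading_induction {i : ℤ} {P : (a : K[X] ⊗[K] M) → a ∈ polyGrading 𝓜 i → Prop}
    (tmul : ∀ (p : K[X]) (x : M) (hx : x ∈ 𝓜 i), P (p ⊗ₜ x) (tmul_mem_polyGrading p hx))
    (zero : P 0 (zero_mem _))
    (add : ∀ a b ha hb, P a ha → P b hb → P (a + b) (add_mem ha hb)) {a : K[X] ⊗[K] M}
    (ha : a ∈ polyGrading 𝓜 i) : P a ha := by
  -- Proving the claim for all multiples absorbs the scalar case of span induction, as a scalar can
  -- be moved into the polynomial factor.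
  have h : ∀ c : K, P (c • a) (Submodule.smul_mem _ c ha) := by
    induction ha using Submodule.span_induction with
    | mem a h =>
      obtain ⟨p, x, hx, rfl⟩ := h
      exact fun c => tmul (c • p) x hx
    | zero => intro c; simpa only [smul_zero] using zero
    | add a b _ _ ha hb => intro c; simpa only [smul_add] using add _ _ _ _ (ha c) (hb c)
    | smul c a _ h => intro c'; simpa only [smul_smul] using h (c' * c)
  simpa only [one_smul] using h 1

theorem polySign_of_mem [DirectSum.Decomposition 𝓜] {i : ℤ} {a : K[X] ⊗[K] M}
    (ha : a ∈ polyGrading 𝓜 i) : polySign 𝓜 a = i.negOnePow • a := by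
  induction ha using polyGrading_induction with
  | tmul p x hx =>
    rw [polySign, LinearMap.lTensor_tmul, gradeSign_of_mem 𝓜 hx, Units.smul_def, Units.smul_def,
      TensorProduct.tmul_smul]
  | zero => simp
  | add a b _ _ ha hb => rw [map_add, ha, hb, smul_add]

theorem map_mem_polyGrading (𝓝 : ℤ → Submodule K M) (f : K[X] →ₗ[K] K[X]) (g : M →ₗ[K] M)
    {i j : ℤ} (hg : ∀ x ∈ 𝓜 i, g x ∈ 𝓝 j) {a : K[X] ⊗[K] M} (ha : a ∈ polyGrading 𝓜 i) :
    TensorProduct.map f g a ∈ polyGrading 𝓝 j := by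
  induction ha using polyGrading_induction with
  | tmul p x hx => exact tmul_mem_polyGrading _ (hg x hx)
  | zero => simp
  | add a b _ _ ha hb => rw [map_add]; exact add_mem ha hb

@[simp]
theorem polyBracket_tmul (B : DGLA 𝓜) (p q : K[X]) (x y : M) :
    polyBracket B (p ⊗ₜ x) (q ⊗ₜ y) = (p * q) ⊗ₜ B.bracket x y := by
  simp [polyBracket]

/-- The differential graded Lie algebra `M[t]`. -/
def polyDGLA (B : DGLA 𝓜) : DGLA (polyGrading 𝓜) where
  d := LinearMap.lTensor K[X] B.d
  bracket := polyBracket B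
  d_mem ha := map_mem_polyGrading 𝓜 _ B.d (fun _ hx => B.d_mem hx) ha
  d_d a := by
    induction a with
    | zero => simp
    | add a b ha hb => simp [ha, hb]
    | tmul p x => simp [B.d_d]
  bracket_mem ha hb := by
    induction ha using polyGrading_induction with
    | zero => simp
    | add a a' _ _ h h' => simpa using add_mem h h'
    | tmul p x hx =>
      induction hb using polyGrading_induction with
      | zero => simp
      | add a a' _ _ h h' => simpa using add_mem h h'
      | tmul q y hy => simpa using tmul_mem_polyGrading _ (B.bracket_mem hx hy)
  skew ha hb := by
    induction ha using polyGrading_induction with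
    | zero => simp
    | add a a' _ _ h h' =>
      simp only [map_add, LinearMap.add_apply, h, h', smul_add]
      abel
    | tmul p x hx =>
      induction hb using polyGrading_induction with
      | zero => simp
      | add a a' _ _ h h' =>
        simp only [map_add, LinearMap.add_apply, h, h', smul_add]
        abel
      | tmul q y hy =>
        simp [B.skew hx hy, Units.smul_def, TensorProduct.tmul_smul, TensorProduct.tmul_neg,
          mul_comm]
  jacobi c ha hb := by
    induction ha using polyGrading_induction with
    | zero => simp
    | add a a' _ _ h h' =>
      simp only [map_add, LinearMap.add_apply, h, h', smul_add]
      abel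
    | tmul p x hx =>
      induction hb using polyGrading_induction with
      | zero => simp
      | add a a' _ _ h h' =>
        simp only [map_add, LinearMap.add_apply, h, h', smul_add]
        abel
      | tmul q y hy =>
        induction c with
        | zero => simp
        | add a a' h h' =>
          simp only [map_add, h, h', smul_add]
          abel
        | tmul r z =>
          simp [B.jacobi z hx hy, Units.smul_def, TensorProduct.tmul_smul, TensorProduct.tmul_add,
            mul_assoc, mul_left_comm]
  leibniz b ha := by
    induction ha using polyGrading_induction with
    | zero => simp
    | add a a' _ _ h h' =>
      simp only [map_add, LinearMap.add_apply, h, h', smul_add]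
      abel
    | tmul p x hx =>
      induction b with
      | zero => simp
      | add a a' h h' =>
        simp only [map_add, h, h', smul_add]
        abel
      | tmul q y =>
        simp [B.leibniz y hx, Units.smul_def, TensorProduct.tmul_smul, TensorProduct.tmul_add]

/-- The derivative `d/dt` on `M[t]`. -/
def polyDerivative (K M : Type*) [Field K] [AddCommGroup M] [Module K M] :
    K[X] ⊗[K] M →ₗ[K] K[X] ⊗[K] M :=
  LinearMap.rTensor M Polynomial.derivative

theorem polyDerivative_polyBracket (B : DGLA 𝓜) (a b : K[X] ⊗[K] M) :
    polyDerivative K M (polyBracket B a b) =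
      polyBracket B (polyDerivative K M a) b + polyBracket B a (polyDerivative K M b) := by
  induction a with
  | zero => simp
  | add a a' h h' =>
    simp only [map_add, LinearMap.add_apply, h, h']
    abel
  | tmul p x =>
    induction b with
    | zero => simp
    | add a a' h h' =>
      simp only [map_add, h, h']
      abel
    | tmul q y =>
      simp [polyDerivative, TensorProduct.add_tmul]

theorem polyIntegral_monomial (n : ℕ) (c : K) :
    polyIntegral K (Polynomial.monomial n c) =
      Polynomial.monomial (n + 1) ((n + 1 : K)⁻¹ * c) := by
  rw [polyIntegral, Polynomial.lsum_apply, Polynomial.sum_monomial_index]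
  · simp [Polynomial.smul_monomial]
  · simp

theorem derivative_polyIntegral [CharZero K] (p : K[X]) :
    Polynomial.derivative (polyIntegral K p) = p := by
  induction p using Polynomial.induction_on' with
  | add p q h h' => simp [h, h']
  | monomial n c =>
    rw [polyIntegral_monomial, Polynomial.derivative_monomial]
    have : (n + 1 : K) ≠ 0 := by exact_mod_cast n.succ_ne_zero
    simp [mul_right_comm _ c, inv_mul_cancel₀ this]

theorem polyIntegral_derivative [CharZero K] (p : K[X]) :
    polyIntegral K (Polynomial.derivative p) = p - Polynomial.C (p.eval 0) := by
  induction p using Polynomial.induction_on' with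
  | add p q h h' => simp [h, h']; ring
  | monomial n c =>
    rw [Polynomial.derivative_monomial, polyIntegral_monomial]
    rcases n with _ | n
    · simp
    · have : (n + 1 : K) ≠ 0 := by exact_mod_cast n.succ_ne_zero
      simp [mul_comm c, ← mul_assoc, inv_mul_cancel₀ this]

@[simp]
theorem evalAt_tmul (c : K) (p : K[X]) (x : M) : evalAt M c (p ⊗ₜ x) = p.eval c • x := by
  simp [evalAt, Polynomial.leval]

theorem polyDerivative_integral [CharZero K] (a : K[X] ⊗[K] M) :
    polyDerivative K M (integral K M a) = a := by
  induction a with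
  | zero => simp
  | add a b h h' => simp [h, h']
  | tmul p x => simp [polyDerivative, integral, derivative_polyIntegral]

theorem integral_polyDerivative [CharZero K] (a : K[X] ⊗[K] M) :
    integral K M (polyDerivative K M a) = a - const K M (evalAt M 0 a) := by
  induction a with
  | zero => simp
  | add a b h h' =>
    rw [map_add, map_add, h, h', map_add, map_add]
    abel
  | tmul p x =>
    have : Polynomial.C (p.eval 0) ⊗ₜ[K] x = const K M (evalAt M 0 (p ⊗ₜ x)) := by
      rw [evalAt_tmul, const, TensorProduct.mk_apply, ← TensorProduct.smul_tmul,
        Polynomial.smul_eq_C_mul, mul_one]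
    rw [← this]
    simp [polyDerivative, integral, polyIntegral_derivative, TensorProduct.sub_tmul]

theorem lTensor_integral (f : M →ₗ[K] M) (a : K[X] ⊗[K] M) :
    LinearMap.lTensor K[X] f (integral K M a) = integral K M (LinearMap.lTensor K[X] f a) := by
  induction a with
  | zero => simp
  | add a b h h' => simp [h, h']
  | tmul p x => simp [integral]

theorem evalAt_lTensor (f : M →ₗ[K] M) (c : K) (a : K[X] ⊗[K] M) :
    evalAt M c (LinearMap.lTensor K[X] f a) = f (evalAt M c a) := by
  induction a with
  | zero => simp
  | add a b h h' => simp [h, h']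
  | tmul p x => simp

theorem integral01_lTensor (f : M →ₗ[K] M) (a : K[X] ⊗[K] M) :
    integral01 K M (LinearMap.lTensor K[X] f a) = f (integral01 K M a) := by
  rw [integral01, LinearMap.comp_apply, ← lTensor_integral, evalAt_lTensor, LinearMap.comp_apply]

theorem integral01_polyDerivative [CharZero K] (a : K[X] ⊗[K] M) :
    integral01 K M (polyDerivative K M a) = evalAt M 1 a - evalAt M 0 a := by
  rw [integral01, LinearMap.comp_apply, integral_polyDerivative, map_sub]
  simp [const]

theorem evalAt_mem (c : K) {i : ℤ} {a : K[X] ⊗[K] M} (ha : a ∈ polyGrading 𝓜 i) :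
    evalAt M c a ∈ 𝓜 i := by
  induction ha using polyGrading_induction with
  | zero => simp
  | add a b _ _ h h' => rw [map_add]; exact add_mem h h'
  | tmul p x hx => rw [evalAt_tmul]; exact Submodule.smul_mem _ _ hx

theorem integral_mem {i : ℤ} {a : K[X] ⊗[K] M} (ha : a ∈ polyGrading 𝓜 i) :
    integral K M a ∈ polyGrading 𝓜 i :=
  map_mem_polyGrading 𝓜 _ LinearMap.id (fun _ hx => hx) ha

theorem integral01_mem {i : ℤ} {a : K[X] ⊗[K] M} (ha : a ∈ polyGrading 𝓜 i) :
    integral01 K M a ∈ 𝓜 i :=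
  evalAt_mem 1 (integral_mem ha)

theorem polyDerivative_mem {i : ℤ} {a : K[X] ⊗[K] M} (ha : a ∈ polyGrading 𝓜 i) :
    polyDerivative K M a ∈ polyGrading 𝓜 i :=
  map_mem_polyGrading 𝓜 _ LinearMap.id (fun _ hx => hx) ha

end Poly

/-! ### The path space as a transfer datum -/

section PathSpace

variable {K L M : Type*} [Field K] [AddCommGroup L] [Module K L] [AddCommGroup M] [Module K M]
  {𝓛 : ℤ → Submodule K L} {𝓜 : ℤ → Submodule K M} {A : DGLA 𝓛} {B : DGLA 𝓜}

/-- The operation `q₁ = -d` on `H_χ[1]`. -/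
def pathQ₁ (χ : A.Hom B) : pathSpace χ →ₗ[K] pathSpace χ :=
  LinearMap.restrict (p := pathSpace χ) (q := pathSpace χ)
    (LinearMap.prodMap (-A.d) (LinearMap.prod (-(polyDGLA B).d ∘ₗ LinearMap.fst K _ _)
      ((polyDGLA B).d ∘ₗ LinearMap.snd K _ _ - polyDerivative K M ∘ₗ LinearMap.fst K _ _)))
    (fun x hx => ⟨by
      have h : evalAt M 0 x.2.1 = 0 := hx.1
      simp [polyDGLA, evalAt_lTensor, h], by
      have h : evalAt M 1 x.2.1 = χ.toLinearMap x.1 := hx.2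
      simp [polyDGLA, evalAt_lTensor, h, χ.map_d]⟩)

/-- The grading of `H_χ[1]`. -/
def pathGrading (χ : A.Hom B) (i : ℤ) : Submodule K (pathSpace χ) :=
  ((𝓛 (i + 1)).prod ((polyGrading 𝓜 (i + 1)).prod (polyGrading 𝓜 i))).comap (pathSpace χ).subtype

theorem pathQ₁_apply (χ : A.Hom B) (x : pathSpace χ) : (pathQ₁ χ x).1 =
    (-A.d x.1.1, -(polyDGLA B).d x.1.2.1,
      (polyDGLA B).d x.1.2.2 - polyDerivative K M x.1.2.1) :=
  rfl

variable [DirectSum.Decomposition 𝓛] [DirectSum.Decomposition 𝓜]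

/-- The sign of `q₂` uses the unsuspended degree `i + 1`. In the `dt` part it cancels the sign of
moving `dt` past `a`, so `[a, b']` carries no sign. -/
theorem pathQ₂_apply (χ : A.Hom B) {i : ℤ} {x : pathSpace χ} (hx : x ∈ pathGrading χ i)
    (y : pathSpace χ) : (pathQ₂ χ x y).1 =
      (-(i.negOnePow • A.bracket x.1.1 y.1.1),
        -(i.negOnePow • (polyDGLA B).bracket x.1.2.1 y.1.2.1),
        (polyDGLA B).bracket x.1.2.1 y.1.2.2 -
          i.negOnePow • (polyDGLA B).bracket x.1.2.2 y.1.2.1) := by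
  obtain ⟨hl, ha, hb⟩ := hx
  have hl' := gradeSign_of_mem 𝓛 hl
  have ha' := polySign_of_mem ha
  have hb' := polySign_of_mem hb
  simp only [Submodule.subtype_apply] at hl' ha' hb'
  have e : (pathQ₂ χ x y).1 = (A.bracket (gradeSign 𝓛 x.1.1) y.1.1,
      (polyDGLA B).bracket (polySign 𝓜 x.1.2.1) y.1.2.1,
      (polyDGLA B).bracket (-polySign 𝓜 x.1.2.2) y.1.2.1 +
        (polyDGLA B).bracket (polySign 𝓜 (polySign 𝓜 x.1.2.1)) y.1.2.2) := rfl
  rw [e]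
  rcases Int.units_eq_one_or i.negOnePow with h | h
  · rw [Int.negOnePow_succ, h] at hl' ha'
    rw [h] at hb'
    rw [hl', ha', hb', h]
    simp [ha', neg_add_eq_sub]
  · rw [Int.negOnePow_succ, h] at hl' ha'
    rw [h] at hb'
    rw [hl', ha', hb', h]
    simp [ha', add_comm]

end PathSpace

/-! ### The contraction of the path space onto the cone -/

section PathSpace

variable {K L M : Type*} [Field K] [AddCommGroup L] [Module K L] [AddCommGroup M] [Module K M]
  {𝓛 : ℤ → Submodule K L} {𝓜 : ℤ → Submodule K M} {A : DGLA 𝓛} {B : DGLA 𝓜}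

theorem pathInclusion_apply (χ : A.Hom B) (x : L × M) :
    (pathInclusion χ x).1 = (x.1, tMul K M (χ.toLinearMap x.1), const K M x.2) := rfl

theorem pathProjection_apply (χ : A.Hom B) (x : pathSpace χ) :
    pathProjection χ x = (x.1.1, integral01 K M x.1.2.2) := rfl

theorem pathHomotopy_apply (χ : A.Hom B) (x : pathSpace χ) :
    (pathHomotopy χ x).1 =
      (0, integral K M x.1.2.2 - tMul K M (integral01 K M x.1.2.2), 0) := rfl

theorem polyDerivative_tMul (x : M) : polyDerivative K M (tMul K M x) = const K M x := by
  simp [polyDerivative, tMul, const]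

theorem polyDGLA_d_tMul (B : DGLA 𝓜) (x : M) : (polyDGLA B).d (tMul K M x) = tMul K M (B.d x) := by
  simp [polyDGLA, tMul]

theorem polyDGLA_d_const (B : DGLA 𝓜) (x : M) :
    (polyDGLA B).d (const K M x) = const K M (B.d x) := by
  simp [polyDGLA, const]

theorem coneDifferential_apply (χ : A.Hom B) (x : L × M) :
    coneDifferential χ x = (A.d x.1, χ.toLinearMap x.1 - B.d x.2) := rfl

variable [DirectSum.Decomposition 𝓛] [DirectSum.Decomposition 𝓜]

theorem pathQ₂_mem (χ : A.Hom B) {i j : ℤ} {x y : pathSpace χ} (hx : x ∈ pathGrading χ i)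
    (hy : y ∈ pathGrading χ j) : pathQ₂ χ x y ∈ pathGrading χ (i + j + 1) := by
  have e := pathQ₂_apply χ hx y
  obtain ⟨hl, ha, hb⟩ := hx
  obtain ⟨hl', ha', hb'⟩ := hy
  refine Submodule.mem_comap.2 ?_
  rw [Submodule.subtype_apply, e]
  have e1 : i + 1 + (j + 1) = i + j + 1 + 1 := by ring
  have e2 : i + 1 + j = i + j + 1 := by ring
  have e3 : i + (j + 1) = i + j + 1 := by ring
  have h1 := A.bracket_mem hl hl'
  have h2 := (polyDGLA B).bracket_mem ha ha'
  have h3 := (polyDGLA B).bracket_mem ha hb'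
  have h4 := (polyDGLA B).bracket_mem hb ha'
  rw [e1] at h1 h2
  rw [e2] at h3
  rw [e3] at h4
  exact ⟨neg_mem (intUnits_smul_mem _ h1), neg_mem (intUnits_smul_mem _ h2),
    sub_mem h3 (intUnits_smul_mem _ h4)⟩

theorem pathQ₂_symm (χ : A.Hom B) {i j : ℤ} {x y : pathSpace χ} (hx : x ∈ pathGrading χ i)
    (hy : y ∈ pathGrading χ j) : pathQ₂ χ x y = (i * j).negOnePow • pathQ₂ χ y x := by
  refine Subtype.ext ?_
  have h : ((i * j).negOnePow • pathQ₂ χ y x).1 = (i * j).negOnePow • (pathQ₂ χ y x).1 := rfl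
  rw [h, pathQ₂_apply χ hx, pathQ₂_apply χ hy]
  obtain ⟨hl, ha, hb⟩ := hx
  obtain ⟨hl', ha', hb'⟩ := hy
  have h1 := A.skew hl hl'
  have h2 := (polyDGLA B).skew ha ha'
  have h3 := (polyDGLA B).skew ha hb'
  have h4 := (polyDGLA B).skew hb ha'
  simp only [Submodule.subtype_apply] at h1 h2 h3 h4
  rw [h1, h2, h3, h4]
  by_cases hi : Even i <;> by_cases hj : Even j <;>
    simp [negOnePow_eq_ite, Int.even_mul, hi, hj, sub_eq_add_neg, add_comm,
      ← Int.not_even_iff_odd]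

omit [DirectSum.Decomposition 𝓛] [DirectSum.Decomposition 𝓜] in
theorem pathQ₁_mem (χ : A.Hom B) {i : ℤ} {x : pathSpace χ} (hx : x ∈ pathGrading χ i) :
    pathQ₁ χ x ∈ pathGrading χ (i + 1) := by
  obtain ⟨hl, ha, hb⟩ := hx
  refine Submodule.mem_comap.2 ?_
  rw [Submodule.subtype_apply, pathQ₁_apply]
  exact ⟨neg_mem (A.d_mem hl), neg_mem ((polyDGLA B).d_mem ha),
    sub_mem ((polyDGLA B).d_mem hb) (polyDerivative_mem ha)⟩

theorem pathQ_leibniz (χ : A.Hom B) {i : ℤ} {x : pathSpace χ} (hx : x ∈ pathGrading χ i)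
    (y : pathSpace χ) : pathQ₁ χ (pathQ₂ χ x y) =
      -(pathQ₂ χ (pathQ₁ χ x) y + i.negOnePow • pathQ₂ χ x (pathQ₁ χ y)) := by
  refine Subtype.ext ?_
  have h : (-(pathQ₂ χ (pathQ₁ χ x) y + i.negOnePow • pathQ₂ χ x (pathQ₁ χ y))).1 =
      -((pathQ₂ χ (pathQ₁ χ x) y).1 + i.negOnePow • (pathQ₂ χ x (pathQ₁ χ y)).1) := rfl
  have hp : ∀ a b : K[X] ⊗[K] M, polyDerivative K M ((polyDGLA B).bracket a b) =
      (polyDGLA B).bracket (polyDerivative K M a) b +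
        (polyDGLA B).bracket a (polyDerivative K M b) := polyDerivative_polyBracket B
  rw [h, pathQ₁_apply, pathQ₂_apply χ hx, pathQ₂_apply χ (pathQ₁_mem χ hx), pathQ₂_apply χ hx,
    pathQ₁_apply, pathQ₁_apply]
  obtain ⟨hl, ha, hb⟩ := hx
  have h1 := A.leibniz y.1.1 hl
  have h2 := (polyDGLA B).leibniz y.1.2.1 ha
  have h3 := (polyDGLA B).leibniz y.1.2.2 ha
  have h4 := (polyDGLA B).leibniz y.1.2.1 hb
  simp only [Submodule.subtype_apply] at h1 h2 h3 h4
  by_cases hi : Even i <;>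
    simp [negOnePow_eq_ite, hi, ← Int.not_even_iff_odd] at h1 h2 h3 h4 ⊢ <;>
    simp only [h1, h2, h3, h4, hp] <;> refine ⟨?_, ?_, ?_⟩ <;> abel

theorem pathQ₂_jacobi (χ : A.Hom B) {i j k : ℤ} {x y z : pathSpace χ} (hx : x ∈ pathGrading χ i)
    (hy : y ∈ pathGrading χ j) (hz : z ∈ pathGrading χ k) :
    pathQ₂ χ (pathQ₂ χ x y) z + (i * (j + k)).negOnePow • pathQ₂ χ (pathQ₂ χ y z) x +
      (k * (i + j)).negOnePow • pathQ₂ χ (pathQ₂ χ z x) y = 0 := by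
  refine Subtype.ext ?_
  have h : (pathQ₂ χ (pathQ₂ χ x y) z + (i * (j + k)).negOnePow • pathQ₂ χ (pathQ₂ χ y z) x +
      (k * (i + j)).negOnePow • pathQ₂ χ (pathQ₂ χ z x) y).1 =
      (pathQ₂ χ (pathQ₂ χ x y) z).1 + (i * (j + k)).negOnePow • (pathQ₂ χ (pathQ₂ χ y z) x).1 +
        (k * (i + j)).negOnePow • (pathQ₂ χ (pathQ₂ χ z x) y).1 := rfl
  rw [h, pathQ₂_apply χ (pathQ₂_mem χ hx hy), pathQ₂_apply χ (pathQ₂_mem χ hy hz),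
    pathQ₂_apply χ (pathQ₂_mem χ hz hx), pathQ₂_apply χ hx, pathQ₂_apply χ hy, pathQ₂_apply χ hz]
  obtain ⟨hl, ha, hb⟩ := hx
  obtain ⟨hl', ha', hb'⟩ := hy
  obtain ⟨hl'', ha'', hb''⟩ := hz
  have h1 := A.jacobi_cyclic hl hl' hl''
  have h2 := (polyDGLA B).jacobi_cyclic ha ha' ha''
  have h3 := (polyDGLA B).jacobi_cyclic hb ha' ha''
  have h4 := (polyDGLA B).jacobi_cyclic ha hb' ha''
  have h5 := (polyDGLA B).jacobi_cyclic ha ha' hb''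
  simp only [Submodule.subtype_apply] at h1 h2 h3 h4 h5
  clear hl hl' hl'' ha ha' ha'' hb hb' hb'' h
  by_cases hi : Even i <;> by_cases hj : Even j <;> by_cases hk : Even k <;>
    simp [negOnePow_eq_ite, Int.even_mul, Int.even_add, hi, hj, hk,
      ← Int.not_even_iff_odd] at h1 h2 h3 h4 h5 ⊢
  all_goals refine ⟨?_, ?_, ?_⟩
  -- The `dt` part is a signed sum of three Jacobi identities of `M[t]`, one for each argument that
  -- may carry `dt`; the signs depend on the parities.
  all_goals first
    | linear_combination (norm := abel1) h1
    | linear_combination (norm := abel1) -h1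
    | linear_combination (norm := abel1) h2
    | linear_combination (norm := abel1) -h2
    | linear_combination (norm := abel1) -h3 + h4 - h5
    | linear_combination (norm := abel1) h3 - h4 - h5
    | linear_combination (norm := abel1) -h3 - h4 + h5
    | linear_combination (norm := abel1) h3 + h4 + h5

/-- In the homotopy identity the terms with `B.d` cancel. Integrating the derivative of `a` leaves
`-a + t χ(l)`, by `a(0) = 0` and `a(1) = χ(l)`; differentiating the homotopy leaves `-b + ∫₀¹ b`. -/
theorem isTransferDatum_pathSpace [CharZero K] (χ : A.Hom B) :
    IsTransferDatum (C := L × M) (W := pathSpace χ) (coneGrading 𝓛 𝓜) (pathGrading χ)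
      (pathQ₁ χ) (pathQ₂ χ) (pathInclusion χ) (pathHomotopy χ) (pathProjection χ)
      (-coneDifferential χ) where
  q₁_mem := pathQ₁_mem χ
  q₂_mem := pathQ₂_mem χ
  ι_mem hx := by
    refine Submodule.mem_comap.2 ?_
    rw [Submodule.subtype_apply, pathInclusion_apply]
    exact ⟨hx.1, tmul_mem_polyGrading _ (χ.map_mem hx.1), tmul_mem_polyGrading _ hx.2⟩
  H_mem hx := by
    refine Submodule.mem_comap.2 ?_
    rw [Submodule.subtype_apply, pathHomotopy_apply]
    exact ⟨zero_mem _, sub_mem (integral_mem hx.2.2)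
      (tmul_mem_polyGrading _ (integral01_mem hx.2.2)), zero_mem _⟩
  π_mem hx := ⟨hx.1, integral01_mem hx.2.2⟩
  δ₁_mem hx := by
    rw [LinearMap.neg_apply, coneDifferential_apply]
    exact neg_mem ⟨A.d_mem hx.1, sub_mem (χ.map_mem hx.1) (B.d_mem hx.2)⟩
  symm := pathQ₂_symm χ
  leibniz hx _ := pathQ_leibniz χ hx _
  jacobi := pathQ₂_jacobi χ
  δ₁_δ₁ x := by
    simp [coneDifferential_apply, A.d_d, B.d_d, χ.map_d]
  q₁_ι x := by
    refine Subtype.ext ?_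
    rw [pathQ₁_apply, pathInclusion_apply, pathInclusion_apply, LinearMap.neg_apply,
      coneDifferential_apply]
    simp [polyDerivative_tMul, polyDGLA_d_tMul, polyDGLA_d_const, χ.map_d]
  π_q₁ x := by
    rw [pathProjection_apply, pathQ₁_apply, pathProjection_apply, LinearMap.neg_apply,
      coneDifferential_apply]
    have h : integral01 K M ((polyDGLA B).d x.1.2.2) = B.d (integral01 K M x.1.2.2) :=
      integral01_lTensor B.d _
    simp [integral01_polyDerivative, h, x.2.1, x.2.2]
  homotopy x := by
    refine Subtype.ext ?_
    have h : (pathQ₁ χ (pathHomotopy χ x) + pathHomotopy χ (pathQ₁ χ x)).1 =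
        (pathQ₁ χ (pathHomotopy χ x)).1 + (pathHomotopy χ (pathQ₁ χ x)).1 := rfl
    have h' : (pathInclusion χ (pathProjection χ x) - x).1 =
        (pathInclusion χ (pathProjection χ x)).1 - x.1 := rfl
    rw [h, h', pathQ₁_apply, pathHomotopy_apply, pathHomotopy_apply, pathQ₁_apply,
      pathInclusion_apply, pathProjection_apply]
    have h1 : integral01 K M ((polyDGLA B).d x.1.2.2) = B.d (integral01 K M x.1.2.2) :=
      integral01_lTensor B.d _
    have h2 : integral K M ((polyDGLA B).d x.1.2.2) = (polyDGLA B).d (integral K M x.1.2.2) :=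
      (lTensor_integral B.d _).symm
    refine Prod.ext ?_ (Prod.ext ?_ ?_)
    · simp
    · simp [h1, h2, integral_polyDerivative, integral01_polyDerivative, polyDGLA_d_tMul, x.2.1,
        x.2.2]
      abel
    · simp [polyDerivative_integral, polyDerivative_tMul]

end PathSpace

/-! ### Nested brackets -/

section Nested

variable {K M : Type*} [Field K] [AddCommGroup M] [Module K M] {𝓜 : ℤ → Submodule K M}

theorem nestedBracket_add (B : DGLA 𝓜) {n : ℕ} (x : Fin n → M) (y y' : M) :
    nestedBracket B x (y + y') = nestedBracket B x y + nestedBracket B x y' := by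
  unfold nestedBracket
  induction List.ofFn x with
  | nil => rfl
  | cons a l ih => simp [ih]

theorem nestedBracket_zero (B : DGLA 𝓜) {n : ℕ} (x : Fin n → M) : nestedBracket B x 0 = 0 := by
  unfold nestedBracket
  induction List.ofFn x with
  | nil => rfl
  | cons a l ih => simp [ih]

theorem nestedBracket_succ (B : DGLA 𝓜) {n : ℕ} (x : Fin (n + 1) → M) (y : M) :
    nestedBracket B x y = B.bracket (x 0) (nestedBracket B (fun i => x i.succ) y) := by
  simp [nestedBracket, List.ofFn_succ]

/-- `∑ ε(σ) [x_{σ(1)}, [x_{σ(2)}, …, [x_{σ(n)}, y] … ]]`. -/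
def symmetrizedBracket (B : DGLA 𝓜) {n : ℕ} (d : Fin n → ℤ) (x : Fin n → M) (y : M) : M :=
  ∑ σ : Equiv.Perm (Fin n), koszulSign σ d • nestedBracket B (fun i => x (σ i)) y

theorem symmetrizedBracket_add (B : DGLA 𝓜) {n : ℕ} (d : Fin n → ℤ) (x : Fin n → M) (y y' : M) :
    symmetrizedBracket B d x (y + y') =
      symmetrizedBracket B d x y + symmetrizedBracket B d x y' := by
  simp [symmetrizedBracket, nestedBracket_add, Finset.sum_add_distrib]

theorem symmetrizedBracket_zero (B : DGLA 𝓜) {n : ℕ} (d : Fin n → ℤ) (x : Fin n → M) :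
    symmetrizedBracket B d x 0 = 0 := by
  simp [symmetrizedBracket, nestedBracket_zero]

/-- The sign of moving the element with index `i` to the front. -/
def frontSign {n : ℕ} (d : Fin (n + 1) → ℤ) (i : Fin (n + 1)) : ℤˣ :=
  ∏ j : Fin n, if i.succAbove j < i then (d i * d (i.succAbove j)).negOnePow else 1

/-- The permutation taking `0` to `i` and the remaining places to the remaining elements as
prescribed by `τ`. -/
def permCons {n : ℕ} (i : Fin (n + 1)) (τ : Equiv.Perm (Fin n)) : Equiv.Perm (Fin (n + 1)) :=
  (finSuccEquiv' 0).trans ((Equiv.optionCongr τ).trans (finSuccEquiv' i).symm)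

@[simp]
theorem permCons_zero {n : ℕ} (i : Fin (n + 1)) (τ : Equiv.Perm (Fin n)) :
    permCons i τ 0 = i := by
  simp [permCons]

@[simp]
theorem permCons_succ {n : ℕ} (i : Fin (n + 1)) (τ : Equiv.Perm (Fin n)) (j : Fin n) :
    permCons i τ j.succ = i.succAbove (τ j) := by
  have h : finSuccEquiv' 0 j.succ = some j := by
    rw [← Fin.zero_succAbove, finSuccEquiv'_succAbove]
  simp [permCons, h]

theorem permCons_bijective (n : ℕ) : Function.Bijective
    fun x : Fin (n + 1) × Equiv.Perm (Fin n) => permCons x.1 x.2 := by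
  rw [Fintype.bijective_iff_injective_and_card]
  constructor
  · rintro ⟨i, τ⟩ ⟨i', τ'⟩ h
    have h0 : i = i' := by simpa using DFunLike.congr_fun h 0
    subst h0
    refine Prod.ext rfl (Equiv.ext fun j => ?_)
    simpa using DFunLike.congr_fun h j.succ
  · simp [Fintype.card_perm, Nat.factorial_succ]

/-- Inversions at place `0` give the sign of moving `i` to the front; the others are those of `τ`,
since `i.succAbove` is increasing. -/
theorem koszulSign_permCons {n : ℕ} (d : Fin (n + 1) → ℤ) (i : Fin (n + 1))
    (τ : Equiv.Perm (Fin n)) :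
    koszulSign (permCons i τ) d = frontSign d i * koszulSign τ (d ∘ i.succAbove) := by
  rw [koszulSign, Fin.prod_univ_succ]
  congr 1
  · rw [Fin.prod_univ_succ, frontSign]
    refine Eq.trans ?_ (Equiv.prod_comp τ _)
    simp
  · refine Finset.prod_congr rfl fun a _ => ?_
    rw [Fin.prod_univ_succ]
    simp [(Fin.strictMono_succAbove i).lt_iff_lt]

/-- Grouping the permutations by their first value gives the same recursion as
`map_transferQuadratic_succ`, with the same signs. -/
theorem symmetrizedBracket_succ (B : DGLA 𝓜) {n : ℕ} (d : Fin (n + 1) → ℤ) (x : Fin (n + 1) → M)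
    (y : M) : symmetrizedBracket B d x y = ∑ i, frontSign d i •
      B.bracket (x i) (symmetrizedBracket B (d ∘ i.succAbove) (x ∘ i.succAbove) y) := by
  rw [symmetrizedBracket, ← (permCons_bijective n).sum_comp, Fintype.sum_prod_type]
  refine Finset.sum_congr rfl fun i _ => ?_
  rw [symmetrizedBracket, map_sum, Finset.smul_sum]
  refine Finset.sum_congr rfl fun τ _ => ?_
  rw [koszulSign_permCons, nestedBracket_succ, map_intUnits_smul, smul_smul]
  simp

end Nested

/-! ### Bernoulli polynomials -/

section Bernoulli

variable (K : Type*) [Field K] [CharZero K]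

/-- The polynomial `(B_n(t) - B_n) / n!`. -/
def homotopyPoly (n : ℕ) : K[X] :=
  ((n.factorial : ℚ)⁻¹ • (Polynomial.bernoulli n - Polynomial.C (bernoulli n))).map
    (algebraMap ℚ K)

theorem homotopyPoly_one : homotopyPoly K 1 = Polynomial.X := by
  have h : Polynomial.C (-1 / 2 : ℚ) = -Polynomial.C (2⁻¹ : ℚ) := by
    rw [← map_neg]
    norm_num
  simp [homotopyPoly, h]

theorem derivative_homotopyPoly (n : ℕ) :
    Polynomial.derivative (homotopyPoly K (n + 1)) =
      homotopyPoly K n + Polynomial.C ((bernoulli n / n.factorial : ℚ) : K) := by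
  have h : (((n + 1).factorial : ℚ)⁻¹ * (n + 1)) = (n.factorial : ℚ)⁻¹ := by
    have h1 : (n + 1 : ℚ) ≠ 0 := by exact_mod_cast n.succ_ne_zero
    rw [Nat.factorial_succ]
    push_cast
    rw [mul_inv, mul_right_comm, inv_mul_cancel₀ h1, one_mul]
  have e : Polynomial.derivative (((n + 1).factorial : ℚ)⁻¹ •
      (Polynomial.bernoulli (n + 1) - Polynomial.C (bernoulli (n + 1)))) =
      (n.factorial : ℚ)⁻¹ • (Polynomial.bernoulli n - Polynomial.C (bernoulli n)) +
        Polynomial.C (bernoulli n / n.factorial : ℚ) := by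
    rw [Polynomial.derivative_smul, Polynomial.derivative_sub, Polynomial.derivative_C, sub_zero,
      Polynomial.derivative_bernoulli_add_one, ← h]
    simp only [Polynomial.smul_eq_C_mul, map_mul, map_add, map_natCast, map_one, div_eq_mul_inv,
      ← h]
    ring
  rw [homotopyPoly, Polynomial.derivative_map, e, Polynomial.map_add, homotopyPoly,
    Polynomial.map_C, eq_ratCast (algebraMap ℚ K)]

theorem eval_zero_homotopyPoly (n : ℕ) : (homotopyPoly K n).eval 0 = 0 := by
  rw [homotopyPoly, ← map_zero (algebraMap ℚ K), Polynomial.eval_map_algebraMap,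
    Polynomial.aeval_algebraMap_apply]
  simp [Polynomial.bernoulli_eval_zero]

/-- `B_n(1)` and `B_n(0)` differ only for `n = 1`. -/
theorem eval_one_homotopyPoly {n : ℕ} (hn : n ≠ 1) : (homotopyPoly K n).eval 1 = 0 := by
  rw [homotopyPoly, ← map_one (algebraMap ℚ K), Polynomial.eval_map_algebraMap,
    Polynomial.aeval_algebraMap_apply]
  simp [Polynomial.bernoulli_eval_one, bernoulli_eq_bernoulli'_of_ne_one hn]

theorem polyIntegral_homotopyPoly (n : ℕ) : polyIntegral K (homotopyPoly K n) =
    homotopyPoly K (n + 1) - ((bernoulli n / n.factorial : ℚ) : K) • Polynomial.X := by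
  have h := polyIntegral_derivative (homotopyPoly K (n + 1))
  rw [derivative_homotopyPoly, map_add, eval_zero_homotopyPoly, map_zero, sub_zero,
    ← Polynomial.monomial_zero_left, polyIntegral_monomial] at h
  rw [← h, ← Polynomial.monomial_one_one_eq_X, Polynomial.smul_monomial]
  simp

variable {K} {M : Type*} [AddCommGroup M] [Module K M]

/-- The Bernoulli numbers of the brackets arise here. The case `n = 0` is different: the polynomial
is zero while `B_0 = 1`. -/
theorem integral01_homotopyPoly {n : ℕ} (hn : n ≠ 0) (y : M) :
    integral01 K M (homotopyPoly K n ⊗ₜ y) = -((bernoulli n / n.factorial : ℚ) : K) • y := by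
  rw [integral01, LinearMap.comp_apply, integral, LinearMap.rTensor_tmul, evalAt_tmul,
    polyIntegral_homotopyPoly, Polynomial.eval_sub, eval_one_homotopyPoly K (by omega)]
  simp

/-- The homotopy raises the index by one: subtracting `t ∫₀¹` removes exactly the linear term left
over by integration. -/
theorem integral_sub_homotopyPoly {n : ℕ} (hn : n ≠ 0) (y : M) :
    integral K M (homotopyPoly K n ⊗ₜ y) - tMul K M (integral01 K M (homotopyPoly K n ⊗ₜ y)) =
      homotopyPoly K (n + 1) ⊗ₜ y := by
  rw [integral01_homotopyPoly hn, integral, LinearMap.rTensor_tmul, polyIntegral_homotopyPoly,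
    tMul, map_smul, TensorProduct.mk_apply, TensorProduct.sub_tmul, TensorProduct.smul_tmul']
  simp [TensorProduct.neg_tmul]

end Bernoulli

/-! ### The recursion of homotopy transfer modulo products of two values of the homotopy -/

section Recursion

variable {K C W : Type*} [Field K] [CharZero K] [AddCommGroup C] [Module K C] [AddCommGroup W]
  [Module K W] {𝓒 : ℤ → Submodule K C} [DirectSum.Decomposition 𝓒] {𝓦 : ℤ → Submodule K W}
  {q₁ : W →ₗ[K] W} {q₂ : W →ₗ[K] W →ₗ[K] W} {ι : C →ₗ[K] W} {H : W →ₗ[K] W} {π : W →ₗ[K] C}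
  {δ₁ : C →ₗ[K] C} (D : IsTransferDatum 𝓒 𝓦 q₁ q₂ ι H π δ₁)
include D

omit [CharZero K] D in
theorem onFinset_transferMap_singleton {I : Type*} [LinearOrder I] (v : I → C) (i : I) :
    onFinset (transferMap 𝓒 q₂ ι H) v {i} = ι (v i) := by
  rw [onFinset_singleton]
  simp [transferMap]

theorem transferQuadratic_two (v : Fin 2 → C) :
    transferQuadratic 𝓒 q₂ ι H 2 v = q₂ (ι (v 0)) (ι (v 1)) := by
  -- Equality of multilinear maps may be tested on homogeneous vectors, and then holds for arbitrary
  -- ones.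
  have e : transferQuadratic 𝓒 q₂ ι H 2 = pairing q₂ (show 1 + 1 = 2 from rfl)
      (MultilinearMap.ofSubsingleton K C W 0 ι) (MultilinearMap.ofSubsingleton K C W 0 ι) := by
    refine multilinearMap_ext_homogeneous 𝓒 fun d v hv => ?_
    have h := transferQuadratic_cons D {(1 : Fin 2)} (v := v) (d := d) (fun i _ => hv i) (hv 0)
    have h1 : onFinset (transferMap 𝓒 q₂ ι H) v {(1 : Fin 2)} = ι (v 1) :=
      onFinset_transferMap_singleton ..
    have h2 : onList (transferMap 𝓒 q₂ ι H) [v 0] = ι (v 0) := by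
      change transferMap 𝓒 q₂ ι H 1 [v 0].get = ι (v 0)
      simp [transferMap]
    have h3 : (Finset.powerset {(1 : Fin 2)}) = {∅, {1}} := rfl
    rw [h3, Finset.sum_pair (Finset.singleton_ne_empty _).symm, Finset.sdiff_self,
      onFinset_empty _ (transferMap_zero ..), Finset.sdiff_empty, h1, Finset.sort_empty,
      List.map_nil, h2, Finset.sort_singleton] at h
    rw [pairing_apply, ← onList_ofFn (fun n => transferQuadratic 𝓒 q₂ ι H n)]
    simpa using h
  rw [e, pairing_apply]
  rfl

/-- If neither part of a partition is a singleton, both factors are values of `H` and `ρ` kills the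
product. For `k ≥ 2` the two parts are never both singletons, so each index occurs in two equal
terms, cancelling `½`. -/
theorem map_transferQuadratic_succ {X : Type*} [AddCommGroup X] [Module K X] (ρ : W →ₗ[K] X)
    (hρ : ∀ x y, ρ (q₂ (H x) (H y)) = 0) {k : ℕ} (hk : 2 ≤ k) {d : Fin (k + 1) → ℤ}
    {v : Fin (k + 1) → C} (hv : ∀ i, v i ∈ 𝓒 (d i)) :
    ρ (transferQuadratic 𝓒 q₂ ι H (k + 1) v) = ∑ i, frontSign d i •
      ρ (q₂ (ι (v i)) (transferMap 𝓒 q₂ ι H k (v ∘ i.succAbove))) := by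
  set F := onFinset (transferMap 𝓒 q₂ ι H) v with hF
  set s : Finset (Fin (k + 1)) → X := fun P => crossSign d P Pᶜ • ρ (q₂ (F P) (F Pᶜ)) with hs
  have hcompl : ∀ P, s Pᶜ = s P := by
    intro P
    simp only [hs, compl_compl]
    rw [D.symm (transferMap_mem D P fun i _ => hv i).2 (transferMap_mem D Pᶜ fun i _ => hv i).2,
      map_intUnits_smul, smul_smul, crossSign_comm d (disjoint_compl_left (a := P)), mul_comm,
      mul_comm (∑ i ∈ P, d i)]
  have hH : ∀ P : Finset (Fin (k + 1)), P.card ≠ 1 →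
      F P = H (onFinset (transferQuadratic 𝓒 q₂ ι H) v P) := by
    intro P hP
    rw [hF, onFinset_transferMap, onFinset_linearPart_eq_zero v hP, map_zero, zero_add]
  have hsplit : ∀ P, s P = (if P.card = 1 then s P else 0) + if Pᶜ.card = 1 then s Pᶜ else 0 := by
    intro P
    have hc := Finset.card_add_card_compl P
    rw [Fintype.card_fin] at hc
    by_cases h1 : P.card = 1
    · rw [if_pos h1, if_neg (by omega), add_zero]
    · by_cases h2 : Pᶜ.card = 1
      · rw [if_neg h1, if_pos h2, zero_add, hcompl]
      · rw [if_neg h1, if_neg h2, add_zero]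
        simp only [hs]
        rw [hH P h1, hH _ h2, hρ, smul_zero]
  have hsum : ∑ P, s P = (2 : K) • ∑ i, s {i} := by
    have h1 : ∑ P : Finset (Fin (k + 1)), (if P.card = 1 then s P else 0) = ∑ i, s {i} := by
      rw [← Finset.sum_filter, Finset.univ_filter_card_eq, Finset.powersetCard_one,
        Finset.sum_map]
      rfl
    have h2 := (compl_bijective (α := Finset (Fin (k + 1)))).sum_comp
      fun P => if P.card = 1 then s P else 0
    rw [Finset.sum_congr rfl fun P _ => hsplit P, Finset.sum_add_distrib, h2, h1, two_smul]
  rw [transferQuadratic, quadraticPart_apply 𝓒 q₂ _ (transferMap_zero ..) hv, map_smul, map_sum]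
  simp only [map_intUnits_smul]
  change (2⁻¹ : K) • ∑ P, s P = _
  rw [hsum, smul_smul, inv_mul_cancel₀ two_ne_zero, one_smul]
  refine Finset.sum_congr rfl fun i _ => ?_
  have hi : ({i}ᶜ : Finset (Fin (k + 1))) = Finset.univ.map i.succAboveEmb := by
    ext j
    simp [Fin.exists_succAbove_eq_iff]
  have h1 : F {i} = ι (v i) := onFinset_transferMap_singleton ..
  have h2 : F {i}ᶜ = transferMap 𝓒 q₂ ι H k (v ∘ i.succAbove) := by
    rw [hF, hi, onFinset_map _ _ _ (Fin.strictMono_succAbove i), onFinset_univ]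
    rfl
  have h3 : crossSign d {i} {i}ᶜ = frontSign d i := by
    rw [hi]
    simp [crossSign, frontSign]
  simp only [hs]
  rw [h1, h2, h3]

end Recursion

/-! ### The brackets of the mapping cone -/

section ConeBracket

variable {K L M : Type*} [Field K] [AddCommGroup L] [Module K L] [AddCommGroup M] [Module K M]
  {𝓛 : ℤ → Submodule K L} {𝓜 : ℤ → Submodule K M} {A : DGLA 𝓛} {B : DGLA 𝓜}

/-- `(l, a + dt · b) ↦ (l, b)`. -/
def pathResidue (χ : A.Hom B) : pathSpace χ →ₗ[K] L × (K[X] ⊗[K] M) :=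
  LinearMap.prodMap LinearMap.id (LinearMap.snd K _ _) ∘ₗ (pathSpace χ).subtype

theorem pathResidue_apply (χ : A.Hom B) (x : pathSpace χ) :
    pathResidue χ x = (x.1.1, x.1.2.2) := rfl

theorem pathProjection_eq (χ : A.Hom B) (x : pathSpace χ) : pathProjection χ x =
    ((pathResidue χ x).1, integral01 K M (pathResidue χ x).2) := rfl

theorem pathHomotopy_eq_zero (χ : A.Hom B) {x : pathSpace χ} (h : (pathResidue χ x).2 = 0) :
    pathHomotopy χ x = 0 := by
  rw [pathResidue_apply] at h
  refine Subtype.ext ?_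
  rw [pathHomotopy_apply, h]
  simp

theorem polyBracket_const_tmul (B : DGLA 𝓜) (m : M) (p : K[X]) (y : M) :
    polyBracket B (const K M m) (p ⊗ₜ y) = p ⊗ₜ B.bracket m y := by
  simp [polyBracket, const]

variable [DirectSum.Decomposition 𝓛] [DirectSum.Decomposition 𝓜]

theorem pathResidue_pathQ₂ (χ : A.Hom B) (x y : pathSpace χ) : pathResidue χ (pathQ₂ χ x y) =
    (A.bracket (gradeSign 𝓛 x.1.1) y.1.1, -polyBracket B (polySign 𝓜 x.1.2.2) y.1.2.1 +
      polyBracket B (polySign 𝓜 (polySign 𝓜 x.1.2.1)) y.1.2.2) := by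
  simp [pathResidue, pathQ₂, formBracket, formSign]

/-- Values of the homotopy lie in `M[t]`, and a bracket of two such elements acquires neither an `L`
part nor a `dt` part. -/
theorem pathResidue_pathQ₂_homotopy (χ : A.Hom B) (x y : pathSpace χ) :
    pathResidue χ (pathQ₂ χ (pathHomotopy χ x) (pathHomotopy χ y)) = 0 := by
  rw [pathResidue_pathQ₂, pathHomotopy_apply, pathHomotopy_apply]
  simp

theorem pathResidue_pathQ₂_inl (χ : A.Hom B) (l : L) (y : pathSpace χ) :
    pathResidue χ (pathQ₂ χ (pathInclusion χ (l, 0)) (pathHomotopy χ y)) = 0 := by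
  rw [pathResidue_pathQ₂, pathInclusion_apply, pathHomotopy_apply]
  simp

theorem polySign_const {i : ℤ} {m : M} (hm : m ∈ 𝓜 i) :
    polySign 𝓜 (const K M m) = i.negOnePow • const K M m := by
  rw [← map_intUnits_smul, ← gradeSign_of_mem 𝓜 hm]
  simp [polySign, const]

theorem pathResidue_pathQ₂_inr (χ : A.Hom B) {i : ℤ} {m : M} (hm : m ∈ 𝓜 i) (y : pathSpace χ) :
    pathResidue χ (pathQ₂ χ (pathInclusion χ (0, m)) y) =
      (0, -(i.negOnePow • polyBracket B (const K M m) y.1.2.1)) := by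
  rw [pathResidue_pathQ₂, pathInclusion_apply]
  simp only [map_zero, polySign_const hm, LinearMap.zero_apply]
  rcases Int.units_eq_one_or i.negOnePow with h | h <;> simp [h]

theorem coneBracket_apply (χ : A.Hom B) {n : ℕ} (hn : n ≠ 1) (v : Fin n → L × M) :
    coneBracket χ n v = pathProjection χ (transferQuadratic (W := pathSpace χ)
      (coneGrading 𝓛 𝓜) (pathQ₂ χ) (pathInclusion χ) (pathHomotopy χ) n v) := by
  rw [coneBracket, transferBracket_apply, linearPart_eq_zero hn]
  simp

theorem coneBracket_one (χ : A.Hom B) (l : L) (m : M) :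
    coneBracket χ 1 ![(l, m)] = (-A.d l, -χ.toLinearMap l + B.d m) := by
  simp [coneBracket, transferBracket, coneDifferential_apply, neg_add_eq_sub]

variable [CharZero K]

theorem coneBracket_two (χ : A.Hom B) (x y : L × M) : coneBracket χ 2 ![x, y] =
    pathProjection χ (pathQ₂ χ (pathInclusion χ x) (pathInclusion χ y)) := by
  rw [coneBracket_apply χ (by decide), transferQuadratic_two (isTransferDatum_pathSpace χ)]
  rfl

theorem coneBracket_inl_inl (χ : A.Hom B) {i : ℤ} {l₁ : L} (l₂ : L) (h : l₁ ∈ 𝓛 i) :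
    coneBracket χ 2 ![(l₁, 0), (l₂, 0)] = (i.negOnePow • A.bracket l₁ l₂, 0) := by
  rw [coneBracket_two, pathProjection_eq, pathResidue_pathQ₂, pathInclusion_apply,
    pathInclusion_apply]
  rcases Int.units_eq_one_or i.negOnePow with h' | h' <;> simp [gradeSign_of_mem 𝓛 h, h']

theorem coneBracket_inr_inl (χ : A.Hom B) {i : ℤ} {m : M} (l : L) (h : m ∈ 𝓜 i) :
    coneBracket χ 2 ![(0, m), (l, 0)] =
      (0, (2⁻¹ : K) • (i + 1).negOnePow • B.bracket m (χ.toLinearMap l)) := by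
  -- The factor `½` is `-B_1`, as `t` is the first of the homotopy polynomials.
  have e : integral01 K M (Polynomial.X ⊗ₜ B.bracket m (χ.toLinearMap l)) =
      (2⁻¹ : K) • B.bracket m (χ.toLinearMap l) := by
    rw [← homotopyPoly_one, integral01_homotopyPoly one_ne_zero]
    norm_num
  rw [coneBracket_two, pathProjection_eq, pathResidue_pathQ₂_inr χ h, pathInclusion_apply]
  simp only [tMul, TensorProduct.mk_apply, polyBracket_const_tmul, map_neg, map_intUnits_smul, e,
    Int.negOnePow_succ]
  rcases Int.units_eq_one_or i.negOnePow with h' | h' <;> simp [h']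

theorem coneBracket_inr_inr (χ : A.Hom B) (m₁ m₂ : M) :
    coneBracket χ 2 ![(0, m₁), (0, m₂)] = 0 := by
  rw [coneBracket_two, pathProjection_eq, pathResidue_pathQ₂, pathInclusion_apply,
    pathInclusion_apply]
  simp

end ConeBracket

/-! ### Vanishing and Bernoulli formula for the higher brackets -/

section HigherBrackets

variable {K L M : Type*} [Field K] [CharZero K] [AddCommGroup L] [Module K L] [AddCommGroup M]
  [Module K M] {𝓛 : ℤ → Submodule K L} {𝓜 : ℤ → Submodule K M} [DirectSum.Decomposition 𝓛]
  [DirectSum.Decomposition 𝓜] {A : DGLA 𝓛} {B : DGLA 𝓜}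

/-- The components of `q₂ ∘ ι_∞` for the path space. -/
abbrev pathQuadratic (χ : A.Hom B) (n : ℕ) : MultilinearMap K (fun _ : Fin n => L × M)
    (pathSpace χ) :=
  transferQuadratic (W := pathSpace χ) (coneGrading 𝓛 𝓜) (pathQ₂ χ) (pathInclusion χ)
    (pathHomotopy χ) n

/-- The components of `ι_∞` for the path space. -/
abbrev pathTransferMap (χ : A.Hom B) (n : ℕ) : MultilinearMap K (fun _ : Fin n => L × M)
    (pathSpace χ) :=
  transferMap (W := pathSpace χ) (coneGrading 𝓛 𝓜) (pathQ₂ χ) (pathInclusion χ)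
    (pathHomotopy χ) n

omit [CharZero K] [DirectSum.Decomposition 𝓛] [DirectSum.Decomposition 𝓜] in
theorem pathHomotopy_apply_eq (χ : A.Hom B) (x : pathSpace χ) : (pathHomotopy χ x).1.2.1 =
    integral K M (pathResidue χ x).2 - tMul K M (integral01 K M (pathResidue χ x).2) := rfl

omit [CharZero K] in
theorem pathTransferMap_apply (χ : A.Hom B) {n : ℕ} (hn : n ≠ 1) (v : Fin n → L × M) :
    pathTransferMap χ n v = pathHomotopy χ (pathQuadratic χ n v) := by
  rw [pathTransferMap, transferMap_apply, linearPart_eq_zero hn]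
  simp

theorem pathResidue_pathQuadratic_succ (χ : A.Hom B) {n : ℕ} (hn : 2 ≤ n) {d : Fin (n + 1) → ℤ}
    {v : Fin (n + 1) → L × M} (hv : ∀ i, v i ∈ coneGrading 𝓛 𝓜 (d i)) :
    pathResidue χ (pathQuadratic χ (n + 1) v) = ∑ i, frontSign d i • pathResidue χ
      (pathQ₂ χ (pathInclusion χ (v i)) (pathHomotopy χ
        (pathQuadratic χ n (v ∘ i.succAbove)))) := by
  rw [map_transferQuadratic_succ (isTransferDatum_pathSpace χ) (pathResidue χ)
    (pathResidue_pathQ₂_homotopy χ) hn hv]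
  refine Finset.sum_congr rfl fun i _ => ?_
  rw [← pathTransferMap_apply χ (by omega)]

/-- The vector `v i` belongs to `L` if `c i` holds and to `M` otherwise. -/
def IsPure {n : ℕ} (c : Fin n → Bool) (v : Fin n → L × M) : Prop :=
  ∀ i, if c i then (v i).2 = 0 else (v i).1 = 0

/-- In arity two, a pair from `L` leaves the `L` part `± [l₁, l₂]`, so only the `dt` part is sure to
vanish. That suffices for the induction, as the homotopy depends on the `dt` part alone. -/
theorem pathResidue_pathQuadratic_eq_zero (χ : A.Hom B) {n : ℕ} (c : Fin (n + 2) → Bool)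
    (hc : ∑ i, (c i).toNat ≠ 1) {d : Fin (n + 2) → ℤ} {v : Fin (n + 2) → L × M}
    (hv : ∀ i, v i ∈ coneGrading 𝓛 𝓜 (d i)) (hcv : IsPure c v) :
    (pathResidue χ (pathQuadratic χ (n + 2) v)).2 = 0 ∧
      (n ≠ 0 → pathResidue χ (pathQuadratic χ (n + 2) v) = 0) := by
  induction n with
  | zero =>
    refine ⟨?_, fun h => absurd rfl h⟩
    rw [pathQuadratic, transferQuadratic_two (isTransferDatum_pathSpace χ), pathResidue_pathQ₂,
      pathInclusion_apply, pathInclusion_apply]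
    have h0 := hcv 0
    have h1 := hcv 1
    rw [Fin.sum_univ_two] at hc
    cases e0 : c 0 <;> cases e1 : c 1 <;> simp_all
  | succ n ih =>
    suffices h : pathResidue χ (pathQuadratic χ (n + 1 + 2) v) = 0 from
      ⟨by rw [h]; rfl, fun _ => h⟩
    rw [pathResidue_pathQuadratic_succ χ (by omega) hv]
    refine Finset.sum_eq_zero fun i _ => ?_
    rw [Fin.sum_univ_succAbove _ i] at hc
    -- If exactly one of the remaining arguments is from `L`, then so is the removed one, and its
    -- summand vanishes; otherwise the induction hypothesis applies.
    by_cases h : ∑ j, (c (i.succAbove j)).toNat = 1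
    · have hci : c i = true := by
        by_contra hci
        rw [Bool.not_eq_true] at hci
        rw [hci, h] at hc
        exact hc rfl
      have hvi : v i = ((v i).1, 0) := by
        have := hcv i
        rw [hci, if_pos rfl] at this
        exact Prod.ext rfl this
      rw [hvi, pathResidue_pathQ₂_inl, smul_zero]
    · rw [pathHomotopy_eq_zero χ (ih (c ∘ i.succAbove) h (d := d ∘ i.succAbove)
        (v := v ∘ i.succAbove) (fun j => hv _) (fun j => hcv _)).1, map_zero, map_zero, smul_zero]

theorem coneBracket_eq_zero (χ : A.Hom B) {n : ℕ} (hn : 3 ≤ n) (c : Fin n → Bool)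
    (hc : ∑ i, (c i).toNat ≠ 1) {v : Fin n → L × M} (hcv : IsPure c v) :
    coneBracket χ n v = 0 := by
  obtain ⟨n, rfl⟩ := Nat.exists_eq_add_of_le' (by omega : 2 ≤ n)
  -- The vectors need not be homogeneous. Precomposing with the projections to `L` or `M`, which
  -- respect the grading, gives a multilinear map that may be tested on homogeneous vectors.
  let p : Fin (n + 2) → L × M →ₗ[K] L × M := fun i =>
    if c i then LinearMap.inl K L M ∘ₗ LinearMap.fst K L M
      else LinearMap.inr K L M ∘ₗ LinearMap.snd K L M
  have hp : (fun i => p i (v i)) = v := by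
    funext i
    have h := hcv i
    by_cases hci : c i
    · rw [if_pos hci] at h
      simp only [p, if_pos hci]
      exact Prod.ext rfl h.symm
    · rw [if_neg hci] at h
      simp only [p, if_neg hci]
      exact Prod.ext h.symm rfl
  have e : (coneBracket χ (n + 2)).compLinearMap p = 0 := by
    refine multilinearMap_ext_homogeneous (coneGrading 𝓛 𝓜) fun d w hw => ?_
    rw [MultilinearMap.compLinearMap_apply, coneBracket_apply χ (by omega), pathProjection_eq,
      (pathResidue_pathQuadratic_eq_zero χ c hc (d := d) (fun i => ?_) fun i => ?_).2 (by omega)]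
    · simp
    · by_cases hci : c i
      · simp only [p, if_pos hci]
        exact ⟨(hw i).1, zero_mem _⟩
      · simp only [p, if_neg hci]
        exact ⟨zero_mem _, (hw i).2⟩
    · by_cases hci : c i <;> simp [p, hci]
  have h := DFunLike.congr_fun e v
  rwa [MultilinearMap.compLinearMap_apply, hp] at h

theorem coneBracket_append_eq_zero (χ : A.Hom B) {n k : ℕ} (hn : 3 ≤ n + k) (hk : k ≠ 1)
    (m : Fin n → M) (l : Fin k → L) :
    coneBracket χ (n + k) (Fin.append (fun i => (0, m i)) (fun j => (l j, 0))) = 0 := by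
  refine coneBracket_eq_zero χ hn (Fin.append (fun _ => false) (fun _ => true)) ?_ fun i => ?_
  · simpa [Fin.sum_univ_add] using hk
  · refine Fin.addCases (fun i => ?_) (fun i => ?_) i <;> simp

theorem frontSign_castSucc {n : ℕ} (d : Fin (n + 2) → ℤ) (i : Fin (n + 1)) :
    frontSign d i.castSucc = frontSign (d ∘ Fin.castSucc) i := by
  rw [frontSign, Fin.prod_univ_castSucc, frontSign]
  simp [Fin.castSucc_succAbove_castSucc, (Fin.castSucc_lt_last i).not_gt]

/-- Each argument from `M` contributes one bracket, a sign `-(-1)^{d i}` since `dt · m` has degree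
`d i + 1`, and, after the first, one application of the homotopy. -/
theorem pathResidue_pathQuadratic_snoc (χ : A.Hom B) {n : ℕ} (d : Fin (n + 1) → ℤ) {e : ℤ}
    {m : Fin (n + 1) → M} {l : L} (hm : ∀ i, m i ∈ 𝓜 (d i)) (hl : l ∈ 𝓛 (e + 1)) :
    pathResidue χ (pathQuadratic χ (n + 2) (Fin.snoc (α := fun _ => L × M)
      (fun i => (0, m i)) (l, 0))) = (0, (∏ i, -(d i).negOnePow) •
        homotopyPoly K (n + 1) ⊗ₜ symmetrizedBracket B d m (χ.toLinearMap l)) := by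
  induction n with
  | zero =>
    have h0 : (Fin.snoc (α := fun _ => L × M) (fun i : Fin 1 => ((0 : L), m i)) (l, 0) :
        Fin 2 → L × M) 0 = (0, m 0) := rfl
    have h1 : (Fin.snoc (α := fun _ => L × M) (fun i : Fin 1 => ((0 : L), m i)) (l, 0) :
        Fin 2 → L × M) 1 = (l, 0) := rfl
    rw [pathQuadratic, transferQuadratic_two (isTransferDatum_pathSpace χ), h0, h1,
      pathResidue_pathQ₂_inr χ (hm 0), pathInclusion_apply, symmetrizedBracket_succ,
      homotopyPoly_one]
    simp only [tMul, TensorProduct.mk_apply, polyBracket_const_tmul]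
    simp [frontSign, symmetrizedBracket, nestedBracket, koszulSign]
  | succ n ih =>
    have hv : ∀ i, Fin.snoc (α := fun _ => L × M) (fun i => (0, m i)) (l, 0) i ∈
        coneGrading 𝓛 𝓜 (Fin.snoc (α := fun _ => ℤ) d e i) := by
      refine Fin.lastCases ?_ fun i => ?_
      · rw [Fin.snoc_last, Fin.snoc_last]
        exact ⟨hl, zero_mem _⟩
      · rw [Fin.snoc_castSucc, Fin.snoc_castSucc]
        exact ⟨zero_mem _, hm i⟩
    have hd : (Fin.snoc (α := fun _ => ℤ) d e) ∘ Fin.castSucc = d := by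
      funext i
      simp
    have hsnoc : ∀ i : Fin (n + 2), Fin.snoc (α := fun _ => L × M)
        (fun i => ((0 : L), m i)) (l, 0) ∘ i.castSucc.succAbove = Fin.snoc (α := fun _ => L × M)
          (fun j => (0, m (i.succAbove j))) (l, 0) := by
      intro i
      funext j
      refine Fin.lastCases ?_ (fun j => ?_) j
      · simp
      · simp [Fin.castSucc_succAbove_castSucc]
    rw [pathResidue_pathQuadratic_succ χ (by omega) hv, Fin.sum_univ_castSucc]
    simp only [Fin.snoc_last, pathResidue_pathQ₂_inl, smul_zero, add_zero, Fin.snoc_castSucc,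
      frontSign_castSucc, hd, hsnoc]
    rw [symmetrizedBracket_succ, TensorProduct.tmul_sum, Finset.smul_sum]
    have hinr : ∀ z : K[X] ⊗[K] M, ((0 : L), z) = LinearMap.inr K L (K[X] ⊗[K] M) z := fun _ => rfl
    rw [hinr, map_sum]
    refine Finset.sum_congr rfl fun i _ => ?_
    have h := ih (d ∘ i.succAbove) (m := fun j => m (i.succAbove j)) fun j => hm _
    have hP : ∀ y : M, integral K M (homotopyPoly K (n + 1) ⊗ₜ y) =
        homotopyPoly K (n + 2) ⊗ₜ y +
          tMul K M (integral01 K M (homotopyPoly K (n + 1) ⊗ₜ y)) := fun y => by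
      rw [← integral_sub_homotopyPoly n.succ_ne_zero, sub_add_cancel]
    rw [pathResidue_pathQ₂_inr χ (hm i), pathHomotopy_apply_eq, h, Fin.prod_univ_succAbove _ i]
    rcases Int.units_eq_one_or (d i).negOnePow with h' | h' <;>
    rcases Int.units_eq_one_or (∏ j, -(d (i.succAbove j)).negOnePow) with h'' | h'' <;>
    rcases Int.units_eq_one_or (frontSign d i) with h''' | h''' <;>
    simp [h', h'', h''', hP, Function.comp_def, TensorProduct.tmul_neg, polyBracket_const_tmul]

theorem prod_neg_negOnePow {n : ℕ} (d : Fin n → ℤ) :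
    ∏ i, -(d i).negOnePow = (-1) ^ n * (∑ i, d i).negOnePow := by
  rw [Finset.prod_neg, negOnePow_sum, Finset.card_univ, Fintype.card_fin]

omit [CharZero K] in
-- The sign accumulated from `n` arguments is invisible, since `B_n = 0` for odd `n ≥ 3`.
theorem neg_one_pow_smul_bernoulli {n : ℕ} (hn : 2 ≤ n) (x : M) :
    ((-1) ^ n : ℤˣ) • ((bernoulli n / n.factorial : ℚ) : K) • x =
      ((bernoulli n / n.factorial : ℚ) : K) • x := by
  rcases Nat.even_or_odd n with h | h
  · rw [h.neg_one_pow, one_smul]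
  · rw [bernoulli_eq_zero_of_odd h (by omega)]
    simp

theorem coneBracket_snoc_of_mem (χ : A.Hom B) {n : ℕ} (hn : 2 ≤ n) (d : Fin n → ℤ) {e : ℤ}
    {m : Fin n → M} {l : L} (hm : ∀ i, m i ∈ 𝓜 (d i)) (hl : l ∈ 𝓛 e) :
    coneBracket χ (n + 1) (Fin.snoc (α := fun _ => L × M) (fun i => (0, m i)) (l, 0)) =
      (0, -((∑ i, d i).negOnePow • ((bernoulli n / n.factorial : ℚ) : K) •
        symmetrizedBracket B d m (χ.toLinearMap l))) := by
  obtain ⟨n, rfl⟩ := Nat.exists_eq_add_of_le' (by omega : 1 ≤ n)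
  rw [coneBracket_apply χ (by omega), pathProjection_eq,
    -- An element of degree `e` in `L` has degree `e - 1` in the shifted cone.
    pathResidue_pathQuadratic_snoc χ d hm (e := e - 1) (by rwa [sub_add_cancel]),
    map_intUnits_smul, integral01_homotopyPoly (by omega), prod_neg_negOnePow,
    mul_comm ((-1) ^ _)]
  simp only [mul_smul, neg_smul, smul_neg, neg_one_pow_smul_bernoulli hn]

theorem coneBracket_snoc (χ : A.Hom B) {n : ℕ} (hn : 2 ≤ n) (d : Fin n → ℤ)
    {m : Fin n → M} (l : L) (hm : ∀ i, m i ∈ 𝓜 (d i)) :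
    coneBracket χ (n + 1) (Fin.snoc (α := fun _ => L × M) (fun i => (0, m i)) (l, 0)) =
      (0, -((∑ i, d i).negOnePow • ((bernoulli n / n.factorial : ℚ) : K) •
        symmetrizedBracket B d m (χ.toLinearMap l))) := by
  have hu : ∀ l : L, (Fin.snoc (α := fun _ => L × M) (fun i => (0, m i)) (l, 0) :
      Fin (n + 1) → L × M) = Function.update (Fin.snoc (α := fun _ => L × M)
        (fun i => (0, m i)) 0) (Fin.last n) (l, 0) := fun l => by
    rw [Fin.update_snoc_last]
  -- The degree of `l` does not enter the formula and both sides are additive in `l`, so homogeneous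
  -- `l` suffice.
  induction l using DirectSum.Decomposition.inductionOn 𝓛 with
  | zero =>
    rw [hu, Prod.mk_zero_zero, MultilinearMap.map_update_zero, map_zero, symmetrizedBracket_zero,
      smul_zero, smul_zero, neg_zero]
    rfl
  | homogeneous l => exact coneBracket_snoc_of_mem χ hn d hm l.2
  | add l l' h h' =>
    have e : ((l + l', 0) : L × M) = (l, 0) + (l', 0) := by simp
    rw [hu] at h h' ⊢
    rw [e, MultilinearMap.map_update_add, h, h', map_add, symmetrizedBracket_add]
    simp [add_comm]

end HigherBrackets

end ConeLInfinity

end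

open ConeLInfinity in
theorem mainTheorem3 {K L M : Type*} [Field K] [CharZero K]
    [AddCommGroup L] [Module K L] [AddCommGroup M] [Module K M]
    (𝓛 : ℤ → Submodule K L) [DirectSum.Decomposition 𝓛]
    (𝓜 : ℤ → Submodule K M) [DirectSum.Decomposition 𝓜]
    (A : DGLA 𝓛) (B : DGLA 𝓜) (χ : A.Hom B) :
    IsLInfinity (coneGrading 𝓛 𝓜) (coneBracket χ) ∧
    (∀ (l : L) (m : M),
      coneBracket χ 1 ![(l, m)] = (-A.d l, -χ.toLinearMap l + B.d m)) ∧
    (∀ (i : ℤ) (l₁ l₂ : L), l₁ ∈ 𝓛 i →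
      coneBracket χ 2 ![(l₁, 0), (l₂, 0)] = (i.negOnePow • A.bracket l₁ l₂, 0)) ∧
    (∀ (i : ℤ) (m : M) (l : L), m ∈ 𝓜 i →
      coneBracket χ 2 ![(0, m), (l, 0)] =
        (0, (2⁻¹ : K) • (i + 1).negOnePow • B.bracket m (χ.toLinearMap l))) ∧
    (∀ m₁ m₂ : M, coneBracket χ 2 ![(0, m₁), (0, m₂)] = 0) ∧
    (∀ n k : ℕ, 3 ≤ n + k → k ≠ 1 → ∀ (m : Fin n → M) (l : Fin k → L),
      coneBracket χ (n + k) (Fin.append (fun i => (0, m i)) (fun j => (l j, 0))) = 0) ∧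
    (∀ n : ℕ, 2 ≤ n → ∀ (d : Fin n → ℤ) (m : Fin n → M) (l : L), (∀ i, m i ∈ 𝓜 (d i)) →
      coneBracket χ (n + 1) (Fin.snoc (fun i => (0, m i)) (l, 0)) =
        (0, -((∑ i, d i).negOnePow • ((bernoulli n / n.factorial : ℚ) : K) •
          ∑ σ : Equiv.Perm (Fin n), koszulSign σ d •
            nestedBracket B (fun i => m (σ i)) (χ.toLinearMap l)))) := by
  exact ⟨isLInfinity_transferBracket (isTransferDatum_pathSpace χ), coneBracket_one χ,
    fun _ _ l₂ h => coneBracket_inl_inl χ l₂ h, fun _ _ l h => coneBracket_inr_inl χ l h,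
    coneBracket_inr_inr χ, fun _ _ hn hk m l => coneBracket_append_eq_zero χ hn hk m l,
    fun _ hn d _ l hm => coneBracket_snoc χ hn d l hm⟩
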